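/- Let $R$ be a countable Prüfer domain (an integral domain all of whose finitely generated ideals are projective) with field of fractions $K$; all modules are $R$-modules. The rank of a flat module $M$ is $\dim_K(K\otimes_R M)$, and a submodule $B\subseteq C$ is pure if $N\otimes B\to N\otimes C$ is injective for every module $N$. For countable flat modules $C$ and $A$, write $\mathrm{Ext}(C,A)=\mathrm{Ext}^1_R(C,A)$. Given a short exact sequence $0\to S\to P\to C\to 0$ with $P$ countable and projective, the connecting homomorphism identifies $\mathrm{Ext}(C,A)$ with $\hat G/N$, where $\hat G=\mathrm{Hom}(S,A)$ is a Polish module in the topology of pointwise convergence ($A$ discrete) and $N$ is the Polishable submodule of those homomorphisms $S\to A$ that extend to $P$. (A submodule of a Polish module is Polishable if it carries a Polish module topology for which the inclusion is continuous.) The first Solecki submodule $s_1\mathrm{Ext}(C,A)$ is the submodule $\hat H/N$, where $\hat H$ is the smallest submodule of $\hat G$ that contains $N$, is Polishable, and is $\boldsymbol\Pi^0_3$ in $\hat G$. We say that $C$ has $A$-projective length at most $1$ if $s_1\mathrm{Ext}(C,A)=0$, and that $C$ has projective length at most $1$ if this holds for every countable flat module $A$. The module $C$ is coreduced if it has no nonzero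 finitely generated projective direct summand. Let $\mathcal E_1$ be the exact structure on countable flat modules projectively generated by the finite-rank ones: a short exact sequence $0\to A\to B\to C\to 0$ of countable flat modules is in $\mathcal E_1$ if every homomorphism $X\to C$ from a countable flat module $X$ of finite rank lifts to $B$. Let $\mathrm{Ext}_{\mathcal E_1}(C,A)\subseteq\mathrm{Ext}(C,A)$ be the set of classes of the extensions in $\mathcal E_1$. **Theorem.** (a) Let $C$ and $A$ be countable flat modules. Then $\mathrm{Ext}_{\mathcal E_1}(C,A)$ is a submodule of $\mathrm{Ext}(C,A)$. It is equal to the set of classes of the extensions of $C$ by $A$ that split on every finite-rank pure submodule of $C$, i.e. to the intersection of the kernels of the restriction maps $\mathrm{Ext}(C,A)\to\mathrm{Ext}(B,A)$ over all finite-rank pure submodules $B$ of $C$. Furthermore, for every choice of the resolution $0\to S\to P\to C\to 0$ as above, the first Solecki submodule of $\mathrm{Ext}(C,A)$ exists and is equal to $\mathrm{Ext}_{\mathcal E_1}(C,A)$. (b) Let $C$ be a countable coreduced flat module. The following are equivalent: 1. $C$ has projective length at most $1$; 2. $C$ has $A$-projective length at most $1$ for every module $A$ that is a countable direct sum of countable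 finite-rank flat modules; 3. $C$ is a direct summand of a countable direct sum of countable finite-rank flat modules. -/

import Mathlib

open CategoryTheory CategoryTheory.Abelian
open scoped TensorProduct DirectSum

universe u

noncomputable section

namespace FlatExt

/-- A Prüfer domain: an integral domain all of whose finitely generated ideals are projective. -/
class IsPruferDomain (R : Type u) [CommRing R] : Prop extends IsDomain R where
  projective_of_fg : ∀ I : Ideal R, I.FG → Module.Projective R I

/-! ### Modules with a Polish cover and the first Solecki submodule -/

section Solecki

variable {R G : Type u} [CommRing R] [AddCommGroup G] [Module R G] [TopologicalSpace G]

/-- A set is `𝚷⁰₃` if it is a countable intersection of countable unions of closed sets. -/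
def IsPiZeroThree {X : Type u} [TopologicalSpace X] (s : Set X) : Prop :=
  ∃ F : ℕ → ℕ → Set X, (∀ m n, IsClosed (F m n)) ∧ s = ⋂ m, ⋃ n, F m n

/-- A submodule `H` of a topological module `G` is Polishable if it carries a Polish module
topology for which the inclusion into `G` is continuous. -/
def IsPolishable (H : Submodule R G) : Prop :=
  ∃ t : TopologicalSpace H, @PolishSpace H t ∧ @IsTopologicalAddGroup H t _ ∧
    @ContinuousConstSMul R H t _ ∧ @Continuous H G t _ Subtype.val

/-- For a Polish module `G` and a Polishable submodule `N`, presenting the module with a Polish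
cover `G / N`, this says that `H / N` is the first Solecki submodule of `G / N`, i.e. the smallest
`𝚷⁰₃` submodule with a Polish cover of `G / N`. -/
def IsFirstSolecki (N H : Submodule R G) : Prop :=
  IsLeast {L : Submodule R G | N ≤ L ∧ IsPolishable L ∧ IsPiZeroThree (L : Set G)} H

end Solecki

/-! ### `Ext` as a module with a Polish cover -/

section Ext

variable {R : Type u} [CommRing R]

/-- The topology of pointwise convergence on `Hom(S, A)`, where `A` is discrete. -/
@[reducible] def homTopology (S A : Type u) [AddCommGroup S] [Module R S] [AddCommGroup A] [Module R A] :
    TopologicalSpace (S →ₗ[R] A) :=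
  TopologicalSpace.induced (fun (φ : S →ₗ[R] A) (s : S) => φ s)
    (@Pi.topologicalSpace S (fun _ => A) (fun _ => ⊥))

/-- For a homomorphism `π : P → C` with kernel `S`, the submodule `Hom(P|S, A)` of `Hom(S, A)`
consisting of the homomorphisms `S → A` that extend to `P`. -/
def extendable {P C : Type u} [AddCommGroup P] [Module R P] [AddCommGroup C] [Module R C]
    (π : P →ₗ[R] C) (A : Type u) [AddCommGroup A] [Module R A] :
    Submodule R (LinearMap.ker π →ₗ[R] A) :=
  LinearMap.range (LinearMap.lcomp R A (LinearMap.ker π).subtype)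

/-- For a short exact sequence `0 → S → P → C → 0`, given by the surjection `π : P → C`,
the connecting homomorphism `Hom(S, A) → Ext¹(C, A)`. -/
def connecting {C A : ModuleCat.{u} R} {P : Type u} [AddCommGroup P] [Module R P]
    (π : P →ₗ[R] C) (hπ : Function.Surjective π) :
    (LinearMap.ker π →ₗ[R] A) →ₗ[R] Ext C A 1 :=
  (Ext.precompOfLinear (LinearMap.shortExact_shortComplexKer hπ).extClass R A (add_zero 1)).comp
    ((Ext.linearEquiv₀ (R := R)
        (X := (ModuleCat.of R (LinearMap.ker π))) (Y := A)).symm.toLinearMap.comp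
      (ModuleCat.homLinearEquiv (S := R)
        (M := ModuleCat.of R (LinearMap.ker π)) (N := A)).symm.toLinearMap)

/-- The connecting homomorphism `Hom(S, A) → Ext¹(C, A)` is surjective if `P` is projective. -/
theorem connecting_surjective {C A : ModuleCat.{u} R} {P : Type u} [AddCommGroup P] [Module R P]
    [Module.Projective R P] (π : P →ₗ[R] C) (hπ : Function.Surjective π) :
    Function.Surjective (connecting (A := A) π hπ) := by
  intro x
  have hP : Projective (LinearMap.shortComplexKer π).X₂ :=
    (IsProjective.iff_projective P).mp inferInstance
  obtain ⟨y, hy⟩ := Ext.contravariant_sequence_exact₃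
    (LinearMap.shortExact_shortComplexKer hπ) A x (Ext.eq_zero_of_projective _) (add_zero 1)
  obtain ⟨f, rfl⟩ := (Ext.mk₀_bijective _ _).2 y
  exact ⟨f.hom, hy⟩

/-- The kernel of the connecting homomorphism `Hom(S, A) → Ext¹(C, A)` is `Hom(P|S, A)`, so that
`Ext¹(C, A)` is identified with `Hom(S, A) / Hom(P|S, A)` if `P` is projective. -/
theorem ker_connecting {C A : ModuleCat.{u} R} {P : Type u} [AddCommGroup P] [Module R P]
    (π : P →ₗ[R] C) (hπ : Function.Surjective π) :
    LinearMap.ker (connecting (A := A) π hπ) = extendable π A := by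
  ext φ
  constructor
  · intro h
    obtain ⟨y, hy⟩ := Ext.contravariant_sequence_exact₁
      (LinearMap.shortExact_shortComplexKer hπ) A
      (Ext.mk₀ (ModuleCat.ofHom φ : (LinearMap.shortComplexKer π).X₁ ⟶ A)) (add_zero 1) h
    obtain ⟨f, rfl⟩ := (Ext.mk₀_bijective _ _).2 y
    rw [Ext.mk₀_comp_mk₀] at hy
    have := (Ext.mk₀_bijective _ _).1 hy
    exact ⟨f.hom, congrArg ModuleCat.Hom.hom this⟩
  · rintro ⟨f, rfl⟩
    have h := (LinearMap.shortExact_shortComplexKer hπ).extClass_comp_assoc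
      (Ext.mk₀ (ModuleCat.ofHom f : (LinearMap.shortComplexKer π).X₂ ⟶ A)) (h := add_zero 1)
    rw [Ext.mk₀_comp_mk₀] at h
    exact h

/-- For countable flat modules `C`, `A`: the submodule `E` of `Ext¹(C, A)` is the first Solecki
submodule of `Ext¹(C, A)`. Here `Ext¹(C, A)` is a module with a Polish cover through its
presentation as `Hom(S, A) / Hom(P|S, A)` for a projective resolution `0 → S → P → C → 0` by
countable modules; the statement is required for each such resolution, and does not depend on the
choice. -/
def IsFirstSoleckiExt (C A : ModuleCat.{u} R) (E : Submodule R (Ext C A 1)) : Prop :=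
  ∀ (P : Type u) [AddCommGroup P] [Module R P] [Countable P] [Module.Projective R P]
    (π : P →ₗ[R] C) (hπ : Function.Surjective π),
    letI : TopologicalSpace (LinearMap.ker π →ₗ[R] A) := homTopology _ _
    IsFirstSolecki (extendable π A) (E.comap (connecting (A := A) π hπ))

/-! ### The exact structure `𝓔₁` -/

/-- `M` has finite rank: the `K`-vector space `K ⊗ M` is finite-dimensional, where `K` is the
field of fractions of `R`. -/
def HasFiniteRank (R : Type u) [CommRing R] (M : Type u) [AddCommGroup M] [Module R M] : Prop :=
  Module.Finite (FractionRing R) (FractionRing R ⊗[R] M)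

/-- The short exact sequences of the exact structure projectively generated by the countable flat
modules of finite rank. It is applied only to sequences whose outer terms are countable and flat,
so that the middle term is countable and flat as well. -/
def IsE1Exact (T : ShortComplex (ModuleCat.{u} R)) : Prop :=
  T.ShortExact ∧ ∀ X : ModuleCat.{u} R, Countable X → Module.Flat R X → HasFiniteRank R X →
    ∀ f : X ⟶ T.X₃, ∃ g : X ⟶ T.X₂, g ≫ T.g = f

/-- `Ext_{𝓔₁}(C, A)` inside `Ext¹(C, A)`: the classes of the extensions
`0 → A → B → C → 0` that belong to `𝓔₁`. -/
def extE1 (C A : ModuleCat.{u} R) : Set (Ext C A 1) :=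
  {e | ∃ (B : ModuleCat.{u} R) (i : A ⟶ B) (p : B ⟶ C) (w : i ≫ p = 0)
    (h : (ShortComplex.mk i p w).ShortExact),
    IsE1Exact (ShortComplex.mk i p w) ∧ h.extClass = e}

/-- A submodule `B` of `C` is pure if `N ⊗ B → N ⊗ C` is injective for every module `N`. -/
def IsPureSubmodule {C : Type u} [AddCommGroup C] [Module R C] (B : Submodule R C) : Prop :=
  ∀ (N : Type u) [AddCommGroup N] [Module R N], Function.Injective (B.subtype.lTensor N)

/-- The classes of the extensions of `C` by `A` that split on every finite-rank pure submodule
`B` of `C`, i.e. the intersection of the kernels of the restriction homomorphisms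
`Ext¹(C, A) → Ext¹(B, A)`. -/
def extSplitOnFiniteRank (C A : ModuleCat.{u} R) : Set (Ext C A 1) :=
  {e | ∀ B : Submodule R C, IsPureSubmodule B → HasFiniteRank R B →
    (Ext.mk₀ (ModuleCat.ofHom B.subtype)).comp e (zero_add 1) = 0}

/-! ### Coreduced modules and projective length at most one -/

/-- `C` is coreduced: no nonzero direct summand of `C` is a finitely generated projective
module. -/
def IsCoreduced (C : ModuleCat.{u} R) : Prop :=
  ∀ e : C →ₗ[R] C, e ∘ₗ e = e → Module.Finite R (LinearMap.range e) →
    Module.Projective R (LinearMap.range e) → e = 0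

/-- `C` has `A`-projective length at most one: `Ext¹(C, A)` has Solecki length at most one,
i.e. its first Solecki submodule is trivial. -/
def ProjLengthLEOneAt (C A : ModuleCat.{u} R) : Prop :=
  IsFirstSoleckiExt C A ⊥

/-- `C` has projective length at most one. -/
def ProjLengthLEOne (C : ModuleCat.{u} R) : Prop :=
  ∀ A : ModuleCat.{u} R, Countable A → Module.Flat R A → ProjLengthLEOneAt C A

/-- A sequence of countable finite-rank flat modules. -/
def IsFiniteRankFlatSeq (F : ℕ → ModuleCat.{u} R) : Prop :=
  ∀ n, Countable (F n) ∧ Module.Flat R (F n) ∧ HasFiniteRank R (F n)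

/-- `C` is a direct summand of a countable direct sum of finite-rank flat modules. -/
def IsSummandOfFiniteRankSum (C : ModuleCat.{u} R) : Prop :=
  ∃ F : ℕ → ModuleCat.{u} R, IsFiniteRankFlatSeq F ∧
    ∃ (i : C →ₗ[R] ⨁ n, F n) (r : (⨁ n, F n) →ₗ[R] C), r ∘ₗ i = LinearMap.id

end Ext

end FlatExt

end

/-!
The countable module `C` is the union of an increasing chain of finite-rank pure submodules `C n`,
and each homomorphism from a finite-rank module to `C` takes its values in some `C n`. Hence an
extension of `C` belongs to `𝓔₁` if and only if its class vanishes on all finite-rank pure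
submodules of `C`, or equivalently on all `C n`. Over a Prüfer domain torsion-free modules are flat,
so that pure closures are pure.

**The first Solecki submodule.** Let `S = ker (π : P → C)` and `P n = π⁻¹ (C n)`. The class of
`φ : S → A` vanishes on all `C n` if and only if `φ` lies in the module `H` of the homomorphisms
that extend to each `P n`. A homomorphism on `P n` is determined by its restriction to `S` and its values
at finitely many elements `b n`. Therefore the set of `φ` that extend to `P n` with given values at
`b n` is closed, and `H` is `𝚷⁰₃`. Recording `φ ∈ H` together with the values at `b n` of an
extension to `P n`, modulo those of the homomorphisms that vanish on `S`, identifies `H` with a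
closed submodule `compatibleGerms` of a countable product of Polish modules, so that `H` is Polishable.

The minimality of `H` (`range_le_of_isPiZeroThree`) is a Baire category argument. It needs that
`Hom(P, A)` has dense image in `H`, and that the closure in `Hom(S, A)` of the image of each
neighbourhood of zero in `Hom(P, A)` contains a neighbourhood of zero in `H`. Both follow from the
fact that each homomorphism `P n → A` agrees on each finite set with a homomorphism `P → A`. This
fact, in turn, is the equational criterion for the flatness of `P / P n ≅ C / C n`
(`exists_endomorphism_fixing_finset`).

**Projective length at most one.** By the description of the first Solecki submodule, this means
that all extensions in `𝓔₁` split. If `C` is a direct summand of a direct sum of finite-rank flat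
modules, then the projection onto `C` lifts to each such extension. Conversely, the telescope
`0 → ⨁ C n → ⨁ C n → C → 0` of the chain belongs to `𝓔₁`, and it exhibits `C` as a direct summand of
`⨁ C n` if it splits.
-/

noncomputable section

namespace FlatExt

/-! ### Torsion-free modules and pure submodules over a Prüfer domain -/

section Algebra

variable {R : Type u} [CommRing R]

/-- For a finitely generated ideal `I`, which is flat, the map `I ⊗ M → R ⊗ M` is injective because
it becomes so after composing with `R ⊗ M → R ⊗ (K ⊗ M)`: the composite factors as
`I ⊗ M → I ⊗ (K ⊗ M) → R ⊗ (K ⊗ M)`, where `K ⊗ M` is flat. -/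
theorem flat_of_isTorsionFree [IsPruferDomain R] (M : Type u) [AddCommGroup M] [Module R M]
    [Module.IsTorsionFree R M] : Module.Flat R M := by
  rw [Module.Flat.iff_rTensor_injective]
  intro I hI
  have := IsPruferDomain.projective_of_fg I hI
  set K := FractionRing R
  have hj : Function.Injective (TensorProduct.mk R K M 1) :=
    (injective_iff_map_eq_zero _).2 fun m hm ↦ by
      obtain ⟨s, hs⟩ := (IsLocalizedModule.eq_zero_iff (nonZeroDivisors R)
        (TensorProduct.mk R K M 1)).1 hm
      exact (smul_eq_zero.1 hs).resolve_left (nonZeroDivisors.ne_zero s.2)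
  have h1 : Function.Injective ((TensorProduct.mk R K M 1).lTensor I) :=
    Module.Flat.lTensor_preserves_injective_linearMap _ hj
  have hKM : Module.Flat R (K ⊗[R] M) := Module.Flat.trans R K (K ⊗[R] M)
  have h2 : Function.Injective (I.subtype.rTensor (K ⊗[R] M)) :=
    Module.Flat.rTensor_preserves_injective_linearMap _ I.injective_subtype
  have h3 := h2.comp h1
  rw [← LinearMap.coe_comp, LinearMap.rTensor_comp_lTensor, ← LinearMap.lTensor_comp_rTensor,
    LinearMap.coe_comp] at h3
  exact h3.of_comp

theorem isPureSubmodule_of_flat_quotient {C : Type u} [AddCommGroup C] [Module R C]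
    (B : Submodule R C) [Module.Flat R (C ⧸ B)] : IsPureSubmodule B := by
  intro N _ _
  exact LinearMap.lTensor_injective_of_exact_of_flat B.mkQ B.mkQ_surjective B.subtype
    B.injective_subtype (LinearMap.exact_subtype_mkQ B) N

theorem IsPureSubmodule.flat {C : Type u} [AddCommGroup C] [Module R C] [Module.Flat R C]
    {B : Submodule R C} (hB : IsPureSubmodule B) : Module.Flat R B := by
  rw [Module.Flat.iff_rTensor_preserves_injective_linearMap]
  intro N N' _ _ _ _ f hf
  have h1 : Function.Injective (f.rTensor C) :=
    Module.Flat.rTensor_preserves_injective_linearMap _ hf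
  have h2 := h1.comp (hB N)
  rw [← LinearMap.coe_comp, LinearMap.rTensor_comp_lTensor, ← LinearMap.lTensor_comp_rTensor,
    LinearMap.coe_comp] at h2
  exact h2.of_comp

/-- The pure closure of a set `t` in a module over a domain: the elements with a nonzero multiple
in the span of `t`. -/
def pureClosure [IsDomain R] {C : Type u} [AddCommGroup C] [Module R C] (t : Set C) :
    Submodule R C where
  carrier := {c | ∃ r : R, r ≠ 0 ∧ r • c ∈ Submodule.span R t}
  add_mem' := by
    rintro a b ⟨r, hr, ha⟩ ⟨s, hs, hb⟩
    refine ⟨r * s, mul_ne_zero hr hs, ?_⟩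
    rw [smul_add, mul_comm r s, mul_smul, mul_comm s r, mul_smul]
    exact add_mem (Submodule.smul_mem _ _ ha) (Submodule.smul_mem _ _ hb)
  zero_mem' := ⟨1, one_ne_zero, by simp⟩
  smul_mem' := by
    rintro a b ⟨r, hr, hb⟩
    exact ⟨r, hr, by rw [smul_comm]; exact Submodule.smul_mem _ _ hb⟩

section PureClosure

variable [IsDomain R] {C : Type u} [AddCommGroup C] [Module R C]

theorem mem_pureClosure {t : Set C} {c : C} :
    c ∈ pureClosure (R := R) t ↔ ∃ r : R, r ≠ 0 ∧ r • c ∈ Submodule.span R t := Iff.rfl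

theorem subset_pureClosure (t : Set C) : t ⊆ pureClosure (R := R) t :=
  fun c hc ↦ ⟨1, one_ne_zero, by rw [one_smul]; exact Submodule.subset_span hc⟩

theorem pureClosure_mono {s t : Set C} (h : s ⊆ t) :
    pureClosure (R := R) s ≤ pureClosure t :=
  fun _ ⟨r, hr, hc⟩ ↦ ⟨r, hr, Submodule.span_mono h hc⟩

instance isTorsionFree_quotient_pureClosure (t : Set C) :
    Module.IsTorsionFree R (C ⧸ pureClosure (R := R) t) := by
  refine Module.IsTorsionFree.of_smul_eq_zero fun r x hx ↦ ?_
  obtain ⟨c, rfl⟩ := Submodule.mkQ_surjective _ x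
  by_cases hr : r = 0
  · exact Or.inl hr
  right
  rw [← map_smul] at hx
  obtain ⟨s, hs, h⟩ := (Submodule.Quotient.mk_eq_zero _).1 hx
  exact (Submodule.Quotient.mk_eq_zero _).2 ⟨s * r, mul_ne_zero hs hr, by rwa [mul_smul]⟩

theorem hasFiniteRank_of_pureClosure_eq_top {t : Set C} (ht : t.Finite)
    (h : pureClosure (R := R) t = ⊤) : HasFiniteRank R C := by
  refine ⟨⟨(ht.image (TensorProduct.mk R (FractionRing R) C 1)).toFinset, ?_⟩⟩
  rw [Set.Finite.coe_toFinset, eq_top_iff]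
  rintro x -
  induction x using TensorProduct.induction_on with
  | zero => exact zero_mem _
  | add x y hx hy => exact add_mem hx hy
  | tmul k c =>
    obtain ⟨r, hr, hc⟩ := mem_pureClosure.1 (h ▸ Submodule.mem_top : c ∈ pureClosure (R := R) t)
    have h1 : (1 : FractionRing R) ⊗ₜ[R] (r • c) ∈ Submodule.span (FractionRing R)
        (TensorProduct.mk R (FractionRing R) C 1 '' t) := by
      apply Submodule.span_le_restrictScalars R
      rw [← Submodule.map_span]
      exact ⟨_, hc, rfl⟩
    have h2 : k ⊗ₜ[R] c = (k * (algebraMap R (FractionRing R) r)⁻¹) •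
        ((1 : FractionRing R) ⊗ₜ[R] (r • c)) := by
      have h0 : algebraMap R (FractionRing R) r ≠ 0 := by simpa using hr
      rw [TensorProduct.smul_tmul', smul_eq_mul, mul_one, ← TensorProduct.smul_tmul,
        Algebra.smul_def, mul_comm, inv_mul_cancel_right₀ h0]
    rw [h2]
    exact Submodule.smul_mem _ _ h1

theorem HasFiniteRank.exists_pureClosure_eq_top (h : HasFiniteRank R C) :
    ∃ t : Set C, t.Finite ∧ pureClosure (R := R) t = ⊤ := by
  set K := FractionRing R
  have hspan : Submodule.span K (Set.range (TensorProduct.mk R K C 1)) = ⊤ := by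
    rw [eq_top_iff]
    rintro x -
    induction x using TensorProduct.induction_on with
    | zero => exact zero_mem _
    | add x y hx hy => exact add_mem hx hy
    | tmul k c =>
      have : k ⊗ₜ[R] c = k • ((1 : K) ⊗ₜ[R] c) := by simp [TensorProduct.smul_tmul']
      rw [this]
      exact Submodule.smul_mem _ _ (Submodule.subset_span ⟨c, rfl⟩)
  have hfg : (Submodule.span K (Set.range (TensorProduct.mk R K C 1))).FG := by
    rw [hspan]; exact h.1
  obtain ⟨t', ht', hst'⟩ := (Submodule.fg_span_iff_fg_span_finset_subset _).1 hfg
  classical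
  obtain ⟨t, -, rfl⟩ := Finset.subset_set_image_iff.1 (Set.image_univ ▸ ht')
  refine ⟨t, t.finite_toSet, eq_top_iff.2 fun x _ ↦ ?_⟩
  -- Each element of the `K`-span of `1 ⊗ t` has a common denominator.
  have key : ∀ z ∈ Submodule.span K (TensorProduct.mk R K C 1 '' t),
      ∃ r : R, r ≠ 0 ∧ ∃ y ∈ Submodule.span R (t : Set C), r • z = (1 : K) ⊗ₜ[R] y := by
    intro z hz
    induction hz using Submodule.span_induction with
    | mem z hz =>
      obtain ⟨c, hc, rfl⟩ := hz
      exact ⟨1, one_ne_zero, c, Submodule.subset_span hc, one_smul _ _⟩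
    | zero => exact ⟨1, one_ne_zero, 0, zero_mem _, by simp⟩
    | add a b _ _ ha hb =>
      obtain ⟨r, hr, y, hy, hra⟩ := ha
      obtain ⟨s, hs, w, hw, hsb⟩ := hb
      refine ⟨s * r, mul_ne_zero hs hr, s • y + r • w,
        add_mem (Submodule.smul_mem _ _ hy) (Submodule.smul_mem _ _ hw), ?_⟩
      rw [smul_add, mul_smul, hra, mul_comm, mul_smul, hsb, TensorProduct.tmul_add,
        TensorProduct.tmul_smul, TensorProduct.tmul_smul]
    | smul k a _ ha =>
      obtain ⟨r, hr, y, hy, hra⟩ := ha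
      obtain ⟨p, q, hq, rfl⟩ := IsFractionRing.div_surjective (A := R) k
      refine ⟨q * r, mul_ne_zero (nonZeroDivisors.ne_zero hq) hr, p • y,
        Submodule.smul_mem _ _ hy, ?_⟩
      have hq0 : algebraMap R K q ≠ 0 := by simpa using nonZeroDivisors.ne_zero hq
      rw [mul_smul, smul_comm r, hra, ← algebraMap_smul K q, smul_smul, mul_div_cancel₀ _ hq0,
        algebraMap_smul, TensorProduct.tmul_smul]
  rw [Finset.coe_image] at hst'
  obtain ⟨r, hr, y, hy, hxy⟩ := key ((1 : K) ⊗ₜ[R] x) (by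
    rw [← hst', hspan]; exact Submodule.mem_top)
  rw [← TensorProduct.tmul_smul] at hxy
  obtain ⟨s, hs⟩ := (IsLocalizedModule.eq_iff_exists (nonZeroDivisors R)
    (TensorProduct.mk R K C 1)).1 hxy
  refine ⟨s * r, mul_ne_zero (nonZeroDivisors.ne_zero s.2) hr, ?_⟩
  have hs' : (s : R) • r • x = (s : R) • y := hs
  rw [mul_smul, hs']
  exact Submodule.smul_mem _ _ hy

theorem hasFiniteRank_pureClosure {t : Set C} (ht : t.Finite) :
    HasFiniteRank R (pureClosure (R := R) t) := by
  refine hasFiniteRank_of_pureClosure_eq_top (ht.preimage Subtype.val_injective.injOn)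
    (eq_top_iff.2 fun c _ ↦ ?_)
  obtain ⟨r, hr, hc⟩ := mem_pureClosure.1 c.2
  refine ⟨r, hr, ?_⟩
  have himg : (pureClosure (R := R) t).subtype '' (Subtype.val ⁻¹' t) = t :=
    Set.image_preimage_eq_of_subset fun c hc ↦ ⟨⟨c, subset_pureClosure t hc⟩, rfl⟩
  obtain ⟨c', hc', h⟩ : r • (c : C) ∈
      (Submodule.span R (Subtype.val ⁻¹' t)).map (pureClosure (R := R) t).subtype := by
    rwa [Submodule.map_span, himg]
  rwa [show r • c = c' from Subtype.val_injective h.symm]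

/-- A homomorphism from a module of finite rank takes its values in the pure closure of a finite
set. -/
theorem HasFiniteRank.exists_range_le_pureClosure {X : Type u} [AddCommGroup X] [Module R X]
    (h : HasFiniteRank R X) (f : X →ₗ[R] C) :
    ∃ t : Set C, t.Finite ∧ LinearMap.range f ≤ pureClosure t := by
  obtain ⟨t, ht, htop⟩ := h.exists_pureClosure_eq_top
  refine ⟨f '' t, ht.image f, ?_⟩
  rintro _ ⟨x, rfl⟩
  obtain ⟨r, hr, hx⟩ := mem_pureClosure.1 (htop ▸ Submodule.mem_top : x ∈ pureClosure (R := R) t)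
  refine ⟨r, hr, ?_⟩
  rw [← map_smul, ← Submodule.map_span]
  exact ⟨_, hx, rfl⟩

end PureClosure

theorem isPureSubmodule_pureClosure [IsPruferDomain R] {C : Type u} [AddCommGroup C]
    [Module R C] (t : Set C) :
    IsPureSubmodule (pureClosure (R := R) t) := by
  have := flat_of_isTorsionFree (R := R) (C ⧸ pureClosure (R := R) t)
  exact isPureSubmodule_of_flat_quotient _

/-- The kernel of a homomorphism `q` from a projective module `P` to a flat module is locally a
retract of `P`: each finite set in the kernel is fixed by an endomorphism of `P` with values in the
kernel. -/
theorem exists_endomorphism_fixing_finset {P D : Type u} [AddCommGroup P] [Module R P]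
    [Module.Projective R P] [AddCommGroup D] [Module R D] [Module.Flat R D] (q : P →ₗ[R] D)
    (hq : Function.Surjective q) (X : Finset P) (hX : ∀ x ∈ X, q x = 0) :
    ∃ θ : P →ₗ[R] P, q ∘ₗ θ = 0 ∧ ∀ x ∈ X, θ x = x := by
  classical
  obtain ⟨s, hs⟩ := Module.projective_def.1 (‹_› : Module.Projective R P)
  -- `R^T` is a finite free module through which the presentation of `P` sees all of `X`.
  let T : Finset P := X.biUnion fun x ↦ (s x).support
  let res : (P →₀ R) →ₗ[R] (T →₀ R) := Finsupp.lcomapDomain _ Subtype.val_injective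
  let lc : (T →₀ R) →ₗ[R] P := Finsupp.linearCombination R Subtype.val
  have hres : ∀ x ∈ X, lc (res (s x)) = x := by
    intro x hx
    have h : Finsupp.mapDomain Subtype.val (res (s x)) = s x := by
      refine Finsupp.mapDomain_comapDomain _ Subtype.val_injective _ fun p hp ↦ ?_
      rw [Subtype.range_coe]
      exact Finset.mem_biUnion.2 ⟨x, hx, hp⟩
    conv_rhs => rw [← hs x, ← h, Finsupp.linearCombination_mapDomain, Function.id_comp]
  -- The relations `q x = 0` for `x ∈ X` in the flat module are consequences of relations in a
  -- finite free module, from which one can lift along `q`.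
  obtain ⟨k, a, y, hya, hay⟩ := Module.Flat.exists_factorization_of_comp_eq_zero_of_free
    (f := Finsupp.linearCombination R fun x : X ↦ res (s x)) (x := q ∘ₗ lc) (by
      ext x
      simp [hres _ x.2, hX _ x.2])
  obtain ⟨y', hy'⟩ := Module.projective_lifting_property q y hq
  refine ⟨(lc - y' ∘ₗ a) ∘ₗ res ∘ₗ s, ?_, fun x hx ↦ ?_⟩
  · rw [← LinearMap.comp_assoc, LinearMap.comp_sub, ← LinearMap.comp_assoc a, hy', hya, sub_self,
      LinearMap.zero_comp]
  · have h : a (res (s x)) = 0 := by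
      simpa using LinearMap.congr_fun hay (Finsupp.single ⟨x, hx⟩ 1)
    simp [hres x hx, h]

end Algebra

/-! ### Extensions and their restrictions to submodules -/

section Extensions

variable {R : Type u} [CommRing R]

/-- Every class in `Ext¹(C, A)` is the class of an extension, namely of a pushout of a projective
resolution of `C`. -/
theorem exists_extClass_eq {C A : ModuleCat.{u} R} (e : Ext C A 1) :
    ∃ (B : ModuleCat.{u} R) (i : A ⟶ B) (p : B ⟶ C) (w : i ≫ p = 0)
      (h : (ShortComplex.mk i p w).ShortExact), h.extClass = e := by
  let π : (C →₀ R) →ₗ[R] C := Finsupp.linearCombination R id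
  have hπ : Function.Surjective π := Finsupp.linearCombination_id_surjective R C
  obtain ⟨φ, rfl⟩ := connecting_surjective (A := A) π hπ e
  let rel : LinearMap.ker π →ₗ[R] A × (C →₀ R) := (-φ).prod (LinearMap.ker π).subtype
  let D : Submodule R (A × (C →₀ R)) := LinearMap.range rel
  have hrel (s : LinearMap.ker π) : (φ s, -(s : C →₀ R)) ∈ D := by
    have h : (-φ s, (s : C →₀ R)) ∈ D := ⟨s, rfl⟩
    simpa using D.neg_mem h
  let i : A →ₗ[R] (A × (C →₀ R)) ⧸ D := D.mkQ ∘ₗ LinearMap.inl R _ _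
  let p : ((A × (C →₀ R)) ⧸ D) →ₗ[R] C := D.liftQ (π ∘ₗ LinearMap.snd R _ _) (by
    rintro _ ⟨s, rfl⟩
    exact s.2)
  have w : ModuleCat.ofHom i ≫ ModuleCat.ofHom p = 0 := by
    ext a
    simp [i, p]
  have hex : (ShortComplex.mk (ModuleCat.ofHom i) (ModuleCat.ofHom p) w).ShortExact := by
    refine { exact := ?_, mono_f := ?_, epi_g := ?_ }
    · rw [ShortComplex.moduleCat_exact_iff]
      intro x hx
      obtain ⟨⟨a, c⟩, rfl⟩ := D.mkQ_surjective x
      have hc : π c = 0 := by simpa [p] using hx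
      refine ⟨a + φ ⟨c, hc⟩, ?_⟩
      refine (Submodule.Quotient.eq D).2 ?_
      have h := hrel ⟨c, hc⟩
      rwa [← add_sub_cancel_left a (φ _), ← zero_sub] at h
    · rw [ModuleCat.mono_iff_injective]
      refine (injective_iff_map_eq_zero _).2 fun a ha ↦ ?_
      obtain ⟨s, hs⟩ := (Submodule.Quotient.mk_eq_zero D).1 ha
      have h1 : -φ s = a := congrArg Prod.fst hs
      have h2 : s = 0 := Subtype.ext (congrArg Prod.snd hs)
      rw [← h1, h2, map_zero, neg_zero]
    · rw [ModuleCat.epi_iff_surjective]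
      intro c
      obtain ⟨x, hx⟩ := hπ c
      exact ⟨D.mkQ (0, x), by simpa [p] using hx⟩
  refine ⟨_, _, _, w, hex, ?_⟩
  let T : (LinearMap.shortComplexKer π) ⟶
      (ShortComplex.mk (ModuleCat.ofHom i) (ModuleCat.ofHom p) w) :=
    { τ₁ := ModuleCat.ofHom φ
      τ₂ := ModuleCat.ofHom (D.mkQ ∘ₗ LinearMap.inr R _ _)
      τ₃ := 𝟙 _
      comm₁₂ := by
        ext s
        refine (Submodule.Quotient.eq D).2 ?_
        have h := hrel s
        rwa [← sub_zero (φ s), ← zero_sub] at h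
      comm₂₃ := by
        ext s
        simp [p] }
  have := ShortComplex.ShortExact.extClass_naturality
    (LinearMap.shortExact_shortComplexKer hπ) hex T
  rw [Ext.mk₀_id_comp] at this
  exact this.symm

/-- The restriction to a submodule `B` of `C` of the class of `φ : S → A` vanishes if and only if
`φ` extends to the preimage of `B` in `P`. -/
theorem mk₀_comp_connecting_eq_zero_iff {C A : ModuleCat.{u} R} {P : Type u} [AddCommGroup P]
    [Module R P] (π : P →ₗ[R] C) (hπ : Function.Surjective π) (B : Submodule R C)
    (φ : LinearMap.ker π →ₗ[R] A) :
    (Ext.mk₀ (ModuleCat.ofHom B.subtype)).comp (connecting π hπ φ) (zero_add 1) = 0 ↔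
      ∃ f : B.comap π →ₗ[R] A, f ∘ₗ Submodule.inclusion (LinearMap.ker_le_comap π) = φ := by
  let j : LinearMap.ker π →ₗ[R] B.comap π := Submodule.inclusion (LinearMap.ker_le_comap π)
  let q : B.comap π →ₗ[R] B := π.restrict fun _ h ↦ h
  have w : ModuleCat.ofHom j ≫ ModuleCat.ofHom q = 0 := by
    ext s
    exact s.2
  have hex : (ShortComplex.mk (ModuleCat.ofHom j) (ModuleCat.ofHom q) w).ShortExact := by
    refine { exact := ?_, mono_f := ?_, epi_g := ?_ }
    · rw [ShortComplex.moduleCat_exact_iff]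
      intro x hx
      exact ⟨⟨x.1, congrArg Subtype.val hx⟩, rfl⟩
    · rw [ModuleCat.mono_iff_injective]
      exact Submodule.inclusion_injective (LinearMap.ker_le_comap π)
    · rw [ModuleCat.epi_iff_surjective]
      rintro ⟨c, hc⟩
      obtain ⟨x, rfl⟩ := hπ c
      exact ⟨⟨x, hc⟩, rfl⟩
  let T : (ShortComplex.mk (ModuleCat.ofHom j) (ModuleCat.ofHom q) w) ⟶
      (LinearMap.shortComplexKer π) :=
    { τ₁ := 𝟙 _
      τ₂ := ModuleCat.ofHom (B.comap π).subtype
      τ₃ := ModuleCat.ofHom B.subtype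
      comm₁₂ := rfl
      comm₂₃ := rfl }
  have hnat := ShortComplex.ShortExact.extClass_naturality hex
    (LinearMap.shortExact_shortComplexKer hπ) T
  have hres : (Ext.mk₀ (ModuleCat.ofHom B.subtype)).comp (connecting π hπ φ) (zero_add 1) =
      hex.extClass.comp (Ext.mk₀ (ModuleCat.ofHom φ : ModuleCat.of R (LinearMap.ker π) ⟶ A))
        (add_zero 1) := by
    have h1 : connecting π hπ φ = (LinearMap.shortExact_shortComplexKer hπ).extClass.comp
      (Ext.mk₀ (ModuleCat.ofHom φ : ModuleCat.of R (LinearMap.ker π) ⟶ A)) (add_zero 1) := rfl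
    rw [Ext.comp_mk₀_id] at hnat
    rw [h1, ← Ext.comp_assoc (a₂₃ := 1) _ _ _ (zero_add 1) (add_zero 1) (by lia), ← hnat]
  rw [hres]
  constructor
  · intro h
    obtain ⟨y, hy⟩ := Ext.contravariant_sequence_exact₁ hex A
      (Ext.mk₀ (ModuleCat.ofHom φ : ModuleCat.of R (LinearMap.ker π) ⟶ A)) (add_zero 1) h
    obtain ⟨f, rfl⟩ := (Ext.mk₀_bijective _ _).2 y
    rw [Ext.mk₀_comp_mk₀] at hy
    exact ⟨f.hom, congrArg ModuleCat.Hom.hom ((Ext.mk₀_bijective _ _).1 hy)⟩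
  · rintro ⟨f, rfl⟩
    have h := hex.extClass_comp_assoc
      (Ext.mk₀ (ModuleCat.ofHom f : ModuleCat.of R (B.comap π) ⟶ A)) (h := add_zero 1)
    rw [Ext.mk₀_comp_mk₀] at h
    exact h

/-- A homomorphism `f : X → C` lifts to the extension if the pullback of its class along `f`
vanishes. -/
theorem exists_lift_iff_mk₀_comp_extClass_eq_zero {T : ShortComplex (ModuleCat.{u} R)}
    (hT : T.ShortExact) {X : ModuleCat.{u} R} (f : X ⟶ T.X₃) :
    (∃ g : X ⟶ T.X₂, g ≫ T.g = f) ↔ (Ext.mk₀ f).comp hT.extClass (zero_add 1) = 0 := by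
  constructor
  · rintro ⟨g, rfl⟩
    rw [← Ext.mk₀_comp_mk₀, Ext.comp_assoc (a₂₃ := 1) _ _ _ (zero_add 0) (zero_add 1) (by lia),
      hT.comp_extClass, Ext.comp_zero]
  · intro h
    obtain ⟨y, hy⟩ := Ext.covariant_sequence_exact₃ _ hT (Ext.mk₀ f) (zero_add 1) h
    obtain ⟨g, rfl⟩ := (Ext.mk₀_bijective _ _).2 y
    rw [Ext.mk₀_comp_mk₀] at hy
    exact ⟨g, (Ext.mk₀_bijective _ _).1 hy⟩

/-- The classes that vanish on all finite-rank pure submodules, as a submodule. -/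
def extSplitSubmodule (C A : ModuleCat.{u} R) : Submodule R (Ext C A 1) where
  carrier := extSplitOnFiniteRank C A
  add_mem' ha hb B hB hr := by rw [Ext.comp_add, ha B hB hr, hb B hB hr, add_zero]
  zero_mem' _ _ _ := Ext.comp_zero _ _ _ _ _
  smul_mem' r e he B hB hr := by rw [Ext.comp_smul, he B hB hr, smul_zero]

/-- A homomorphism from a finite-rank module to `C` takes its values in a finite-rank pure submodule
of `C`, so that it lifts to an extension if this submodule does. -/
theorem extE1_eq_extSplitOnFiniteRank [IsPruferDomain R] (C A : ModuleCat.{u} R) (hC : Countable C)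
    (hCf : Module.Flat R C) : extE1 C A = extSplitOnFiniteRank C A := by
  ext e
  constructor
  · rintro ⟨B, i, p, w, h, hE, rfl⟩ D hD hr
    have := hD.flat
    exact (exists_lift_iff_mk₀_comp_extClass_eq_zero h (ModuleCat.ofHom D.subtype)).1
      (hE.2 (ModuleCat.of R D) inferInstance this hr _)
  · intro he
    obtain ⟨B, i, p, w, h, rfl⟩ := exists_extClass_eq e
    refine ⟨B, i, p, w, h, ⟨h, fun X _ _ hr f ↦ ?_⟩, rfl⟩
    obtain ⟨t, ht, hft⟩ := hr.exists_range_le_pureClosure f.hom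
    obtain ⟨g, hg⟩ := (exists_lift_iff_mk₀_comp_extClass_eq_zero h
      (ModuleCat.ofHom (pureClosure (R := R) t).subtype)).2
      (he _ (isPureSubmodule_pureClosure t) (hasFiniteRank_pureClosure ht))
    refine ⟨ModuleCat.ofHom (f.hom.codRestrict _ fun x ↦ hft ⟨x, rfl⟩) ≫ g, ?_⟩
    rw [Category.assoc]
    erw [hg]
    rfl

end Extensions

/-! ### The topology of pointwise convergence -/

section HomTopology

open Topology Filter

attribute [local instance] homTopology

variable {R S A : Type u} [CommRing R] [AddCommGroup S] [Module R S] [AddCommGroup A] [Module R A]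

theorem mem_nhds_hom_iff {φ : S →ₗ[R] A} {U : Set (S →ₗ[R] A)} :
    U ∈ 𝓝 φ ↔ ∃ Y : Finset S, ∀ ψ : S →ₗ[R] A, (∀ s ∈ Y, ψ s = φ s) → ψ ∈ U := by
  let : TopologicalSpace A := ⊥
  have : DiscreteTopology A := ⟨rfl⟩
  rw [nhds_induced, nhds_pi, Filter.mem_comap]
  simp only [nhds_discrete, Filter.mem_pi, Filter.mem_pure]
  constructor
  · rintro ⟨V, ⟨I, hI, T, hT, hTV⟩, hVU⟩
    exact ⟨hI.toFinset, fun ψ hψ ↦ hVU (hTV fun s hs ↦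
      (hψ s (hI.mem_toFinset.2 hs)).symm ▸ hT s : (ψ : S → A) ∈ _)⟩
  · rintro ⟨Y, hY⟩
    exact ⟨_, ⟨Y, Y.finite_toSet, fun s ↦ {φ s}, fun _ ↦ rfl, subset_rfl⟩, fun ψ hψ ↦ hY ψ hψ⟩

theorem setOf_forall_eq_mem_nhds (φ : S →ₗ[R] A) (Y : Finset S) :
    {ψ : S →ₗ[R] A | ∀ s ∈ Y, ψ s = φ s} ∈ 𝓝 φ :=
  mem_nhds_hom_iff.2 ⟨Y, fun _ h ↦ h⟩

theorem isTopologicalAddGroup_hom : IsTopologicalAddGroup (S →ₗ[R] A) := by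
  let : TopologicalSpace A := ⊥
  have : DiscreteTopology A := ⟨rfl⟩
  exact topologicalAddGroup_induced (LinearMap.ltoFun R S A R)

theorem continuousConstSMul_hom : ContinuousConstSMul R (S →ₗ[R] A) where
  continuous_const_smul r := continuous_iff_continuousAt.2 fun φ U hU ↦ by
    obtain ⟨Y, hY⟩ := mem_nhds_hom_iff.1 hU
    exact mem_nhds_hom_iff.2 ⟨Y, fun ψ hψ ↦ hY _ fun s hs ↦ by simp [hψ s hs]⟩

theorem polishSpace_hom [Countable S] [Countable A] : PolishSpace (S →ₗ[R] A) := by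
  let : TopologicalSpace A := ⊥
  have : DiscreteTopology A := ⟨rfl⟩
  have : PolishSpace A := inferInstance
  refine IsClosedEmbedding.polishSpace (f := fun (φ : S →ₗ[R] A) (s : S) ↦ φ s)
    ⟨⟨⟨rfl⟩, DFunLike.coe_injective⟩, ?_⟩
  have h : Set.range (fun (φ : S →ₗ[R] A) (s : S) ↦ φ s) =
      (⋂ p : S × S, {f | f (p.1 + p.2) = f p.1 + f p.2}) ∩
        ⋂ p : R × S, {f | f (p.1 • p.2) = p.1 • f p.2} := by
    ext f
    simp only [Set.mem_range, Set.mem_inter_iff, Set.mem_iInter, Set.mem_ofPred_eq, Prod.forall]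
    constructor
    · rintro ⟨φ, rfl⟩
      exact ⟨map_add φ, map_smul φ⟩
    · rintro ⟨h1, h2⟩
      exact ⟨{ toFun := f, map_add' := h1, map_smul' := h2 }, rfl⟩
  rw [h]
  refine (isClosed_iInter fun p ↦ ?_).inter (isClosed_iInter fun p ↦ ?_)
  · exact isClosed_eq (continuous_apply _) (by fun_prop)
  · exact isClosed_eq (continuous_apply _) ((continuous_of_discreteTopology
      (f := fun a : A ↦ p.1 • a)).comp (continuous_apply _))

end HomTopology

/-! ### Polishable and `𝚷⁰₃` submodules -/

section Abstract

open Topology Filter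

variable {R : Type u} [CommRing R] {G : Type u} [AddCommGroup G] [Module R G] [TopologicalSpace G]

theorem isPolishable_range {Γ : Type u} [AddCommGroup Γ] [Module R Γ] [TopologicalSpace Γ]
    [PolishSpace Γ] [IsTopologicalAddGroup Γ] [ContinuousConstSMul R Γ] (ρ : Γ →ₗ[R] G)
    (hρ : Continuous ρ) (hinj : Function.Injective ρ) : IsPolishable (LinearMap.range ρ) := by
  let e : Γ ≃ₗ[R] LinearMap.range ρ := LinearEquiv.ofInjective ρ hinj
  let t : TopologicalSpace (LinearMap.range ρ) := .induced e.symm inferInstance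
  let h : LinearMap.range ρ ≃ₜ Γ := e.symm.toEquiv.toHomeomorphOfIsInducing ⟨rfl⟩
  refine ⟨t, h.isClosedEmbedding.polishSpace, topologicalAddGroup_induced e.symm,
    ⟨fun r ↦ ?_⟩, ?_⟩
  · refine continuous_induced_rng.2 ?_
    have : e.symm ∘ (fun x ↦ r • x) = (fun x ↦ r • x) ∘ e.symm := by
      ext x
      exact map_smul e.symm r x
    rw [this]
    exact (continuous_const_smul r).comp continuous_induced_dom
  · have : (Subtype.val : LinearMap.range ρ → G) = ρ ∘ e.symm := by
      ext x
      exact congrArg Subtype.val (e.apply_symm_apply x).symm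
    rw [this]
    exact hρ.comp continuous_induced_dom

/-- Let `ι : M → Γ` and `ρ : Γ → G` be continuous homomorphisms, where `M` and `Γ` are Baire and `ι`
has dense range. If the closure in `G` of the image of each neighbourhood of zero in `M` contains
the image of a neighbourhood of zero in `Γ`, then each `𝚷⁰₃` submodule of `G` that contains
the image of `M` contains the image of `Γ`.

The preimage in `Γ` of such a `𝚷⁰₃` submodule is comeager: if `M` is covered by the preimages of
countably many closed sets, one of these has nonempty interior, and a nonempty open set in `M`
yields a nonempty open set in `Γ` by the closure condition. A comeager subgroup is everything,
since it meets each of its cosets. -/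
theorem range_le_of_isPiZeroThree [IsTopologicalAddGroup G]
    {M Γ : Type u} [AddCommGroup M] [Module R M] [TopologicalSpace M] [IsTopologicalAddGroup M]
    [BaireSpace M] [AddCommGroup Γ] [Module R Γ] [TopologicalSpace Γ] [IsTopologicalAddGroup Γ]
    [BaireSpace Γ] (ι : M →ₗ[R] Γ) (ρ : Γ →ₗ[R] G) (hι : Continuous ι) (hρ : Continuous ρ)
    (hdense : DenseRange ι)
    (hcl : ∀ U ∈ 𝓝 (0 : M), ∀ᶠ y in 𝓝 (0 : Γ), ρ y ∈ closure ((ρ ∘ ι) '' U))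
    (L : Submodule R G) (hL : LinearMap.range (ρ ∘ₗ ι) ≤ L) (hL3 : IsPiZeroThree (L : Set G)) :
    LinearMap.range ρ ≤ L := by
  obtain ⟨F, hF, hLF⟩ := hL3
  have hopen : ∀ m, Dense (⋃ j, interior (ρ ⁻¹' F m j)) := by
    intro m
    refine dense_iff_inter_open.2 fun W hW hWne ↦ ?_
    have hWM : IsOpen (ι ⁻¹' W) := hW.preimage hι
    obtain ⟨x, hx⟩ := hdense.exists_mem_open hW hWne
    have hcov : ⋃ j, (ρ ∘ ι) ⁻¹' F m j = Set.univ := by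
      refine Set.eq_univ_of_forall fun x ↦ ?_
      have h : ρ (ι x) ∈ (L : Set G) := hL ⟨x, rfl⟩
      rw [hLF, Set.mem_iInter] at h
      simpa using h m
    obtain ⟨g, hgW, hg⟩ := (dense_iUnion_interior_of_closed
      (fun j ↦ (hF m j).preimage (hρ.comp hι)) hcov).inter_open_nonempty _ hWM ⟨x, hx⟩
    obtain ⟨j, hj⟩ := Set.mem_iUnion.1 hg
    rw [mem_interior_iff_mem_nhds] at hj
    refine ⟨ι g, hgW, Set.mem_iUnion.2 ⟨j, ?_⟩⟩
    rw [mem_interior_iff_mem_nhds]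
    have hU : (fun u ↦ g + u) ⁻¹' ((ρ ∘ ι) ⁻¹' F m j) ∈ 𝓝 (0 : M) :=
      (continuous_const_add g).continuousAt.preimage_mem_nhds (by simpa using hj)
    have hy : ∀ᶠ y in 𝓝 (ι g), ρ (y - ι g) ∈ closure ((ρ ∘ ι) ''
        ((fun u ↦ g + u) ⁻¹' ((ρ ∘ ι) ⁻¹' F m j))) := by
      have ht : Tendsto (fun y ↦ y - ι g) (𝓝 (ι g)) (𝓝 0) := by
        have := (continuous_sub_right (ι g)).tendsto (ι g)
        rwa [sub_self] at this
      exact ht.eventually (hcl _ hU)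
    filter_upwards [hy] with y hy
    have h1 : Set.MapsTo (fun z ↦ ρ (ι g) + z) ((ρ ∘ ι) ''
        ((fun u ↦ g + u) ⁻¹' ((ρ ∘ ι) ⁻¹' F m j))) (F m j) := by
      rintro _ ⟨u, hu, rfl⟩
      simpa using hu
    have h2 := h1.closure (continuous_const_add _) hy
    rw [(hF m j).closure_eq] at h2
    change ρ (ι g) + ρ (y - ι g) ∈ F m j at h2
    rwa [← map_add, add_sub_cancel] at h2
  have hres : ρ ⁻¹' (L : Set G) ∈ residual Γ := by
    have : (⋂ m, ⋃ j, interior (ρ ⁻¹' F m j)) ∈ residual Γ :=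
      countable_iInter_mem.2 fun m ↦
        residual_of_dense_open (isOpen_iUnion fun _ ↦ isOpen_interior) (hopen m)
    refine mem_of_superset this fun y hy ↦ ?_
    rw [Set.mem_preimage, hLF]
    refine Set.mem_iInter.2 fun m ↦ ?_
    obtain ⟨j, hj⟩ := Set.mem_iUnion.1 (Set.mem_iInter.1 hy m)
    exact Set.mem_iUnion.2 ⟨j, (interior_subset hj : y ∈ ρ ⁻¹' F m j)⟩
  rintro _ ⟨x, rfl⟩
  have hres' : (Homeomorph.subLeft x) ⁻¹' (ρ ⁻¹' (L : Set G)) ∈ residual Γ :=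
    tendsto_residual_of_isOpenMap (Homeomorph.subLeft x).continuous
      (Homeomorph.subLeft x).isOpenMap hres
  obtain ⟨y, hy, hy'⟩ := (dense_of_mem_residual (inter_mem hres hres')).nonempty
  have := add_mem (show ρ (x - y) ∈ L from hy') (show ρ y ∈ L from hy)
  rwa [← map_add, sub_add_cancel] at this

end Abstract

/-! ### Homomorphisms that extend to each submodule of a chain -/

section Germs

open Topology Filter

attribute [local instance] homTopology

variable {R P : Type u} (A : Type u) [CommRing R] [AddCommGroup P] [Module R P] [AddCommGroup A]
  [Module R A] {S B : Submodule R P}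

/-- The values at `b` of the homomorphisms `B → A` that vanish on `S`. -/
def vanishingValues (hS : S ≤ B) {k : ℕ} (b : Fin k → B) : Submodule R (Fin k → A) :=
  (LinearMap.ker (LinearMap.lcomp R A (Submodule.inclusion hS))).map
    (LinearMap.pi fun i ↦ LinearMap.applyₗ (b i))

/-- The families of values in `A` at `b`, modulo the values of the homomorphisms `B → A` that vanish
on `S`. It carries the discrete topology. -/
def ValueClasses (hS : S ≤ B) {k : ℕ} (b : Fin k → B) : Type u :=
  (Fin k → A) ⧸ vanishingValues A hS b

namespace ValueClasses

variable (hS : S ≤ B) {k : ℕ} (b : Fin k → B)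

instance : AddCommGroup (ValueClasses A hS b) :=
  inferInstanceAs (AddCommGroup ((Fin k → A) ⧸ vanishingValues A hS b))

instance : Module R (ValueClasses A hS b) :=
  inferInstanceAs (Module R ((Fin k → A) ⧸ vanishingValues A hS b))

instance : TopologicalSpace (ValueClasses A hS b) := ⊥

instance : DiscreteTopology (ValueClasses A hS b) := ⟨rfl⟩

/-- The class of a family of values. -/
def mk : (Fin k → A) →ₗ[R] ValueClasses A hS b := (vanishingValues A hS b).mkQ

variable {A}

theorem mk_surjective : Function.Surjective (mk A hS b) :=
  (vanishingValues A hS b).mkQ_surjective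

theorem mk_eq_mk {a a' : Fin k → A} :
    mk A hS b a = mk A hS b a' ↔ a - a' ∈ vanishingValues A hS b :=
  Submodule.Quotient.eq _

instance [Countable A] : Countable (ValueClasses A hS b) := (mk_surjective hS b).countable

instance [Countable A] : PolishSpace (ValueClasses A hS b) := inferInstance

instance : ContinuousConstSMul R (ValueClasses A hS b) := ⟨fun _ ↦ continuous_of_discreteTopology⟩

end ValueClasses

/-- The homomorphism that takes `f : B → A` to its restriction to `S`, together with its values at
`b` modulo the values of the homomorphisms that vanish on `S`. -/
def restrictAndValues (hS : S ≤ B) {k : ℕ} (b : Fin k → B) :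
    (B →ₗ[R] A) →ₗ[R] (S →ₗ[R] A) × ValueClasses A hS b :=
  (LinearMap.lcomp R A (Submodule.inclusion hS)).prod
    (ValueClasses.mk A hS b ∘ₗ LinearMap.pi fun i ↦ LinearMap.applyₗ (b i))

variable {A}

theorem mem_range_restrictAndValues {hS : S ≤ B} {k : ℕ} {b : Fin k → B} {φ : S →ₗ[R] A}
    {a : Fin k → A} :
    (φ, ValueClasses.mk A hS b a) ∈ LinearMap.range (restrictAndValues A hS b) ↔
      ∃ f : B →ₗ[R] A, f ∘ₗ Submodule.inclusion hS = φ ∧ ∀ i, f (b i) = a i := by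
  constructor
  · rintro ⟨f, hf⟩
    obtain ⟨g, hg, hga⟩ := (ValueClasses.mk_eq_mk hS b).1 (congrArg Prod.snd hf)
    refine ⟨f - g, ?_, fun i ↦ ?_⟩
    · have h1 : f ∘ₗ Submodule.inclusion hS = φ := congrArg Prod.fst hf
      have h2 : g ∘ₗ Submodule.inclusion hS = 0 := hg
      rw [LinearMap.sub_comp, h1, h2, sub_zero]
    · have h : g (b i) = f (b i) - a i := congrFun hga i
      rw [LinearMap.sub_apply, h, sub_sub_cancel]
  · rintro ⟨f, rfl, hf⟩
    exact ⟨f, Prod.ext rfl (congrArg (ValueClasses.mk A hS b) (funext hf))⟩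

theorem eq_of_mem_range_restrictAndValues {hS : S ≤ B} {k : ℕ} {b : Fin k → B} {φ : S →ₗ[R] A}
    {p q : ValueClasses A hS b} (hp : (φ, p) ∈ LinearMap.range (restrictAndValues A hS b))
    (hq : (φ, q) ∈ LinearMap.range (restrictAndValues A hS b)) : p = q := by
  obtain ⟨f, hf⟩ := hp
  obtain ⟨g, hg⟩ := hq
  rw [← show _ = p from congrArg Prod.snd hf, ← show _ = q from congrArg Prod.snd hg]
  refine (ValueClasses.mk_eq_mk hS b).2 ⟨f - g, ?_, rfl⟩
  have h1 : f ∘ₗ Submodule.inclusion hS = φ := congrArg Prod.fst hf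
  have h2 : g ∘ₗ Submodule.inclusion hS = φ := congrArg Prod.fst hg
  change (f - g) ∘ₗ Submodule.inclusion hS = 0
  rw [LinearMap.sub_comp, h1, h2, sub_self]

/-- A homomorphism on `B` with torsion-free values is determined by its values on `b` and on `S` if
each element of `B` has a nonzero multiple in the span of `b` and `S`: its value at `x` is already
determined by its values at `b` and at one element `s` of `S`. -/
theorem exists_mem_determining [IsDomain R] [Module.IsTorsionFree R A] (hS : S ≤ B) {k : ℕ}
    (b : Fin k → B)
    (hb : ∀ x : B, ∃ r : R, r ≠ 0 ∧
      r • (x : P) ∈ Submodule.span R (Set.range fun i ↦ (b i : P)) ⊔ S)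
    (x : B) : ∃ s : S, ∀ f g : B →ₗ[R] A, (∀ i, f (b i) = g (b i)) →
      f (Submodule.inclusion hS s) = g (Submodule.inclusion hS s) → f x = g x := by
  obtain ⟨r, hr, hx⟩ := hb x
  obtain ⟨y, hy, s, hs, hys⟩ := Submodule.mem_sup.1 hx
  refine ⟨⟨s, hs⟩, fun f g hfg hfs ↦ ?_⟩
  obtain ⟨c, hc⟩ := (Submodule.mem_span_range_iff_exists_fun R).1 hy
  have hrx : r • x = ∑ i, c i • b i + Submodule.inclusion hS ⟨s, hs⟩ := by
    apply Subtype.ext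
    simp [← hys, ← hc]
  have h : r • f x = r • g x := by
    rw [← map_smul, ← map_smul, hrx]
    simp [hfg, hfs]
  exact smul_right_injective A hr h

/-- The set of the homomorphisms `φ` that extend to `B` with values at `b` in a given class is
closed. If `φ` is a limit of such homomorphisms, their extensions can be chosen with the same values
at `b`; at each point, the value of an extension depends on a single value on `S`, so that the
extensions of homomorphisms sufficiently close to `φ` agree there. -/
theorem isClosed_setOf_mem_range_restrictAndValues [IsDomain R] [Module.IsTorsionFree R A]
    (hS : S ≤ B) {k : ℕ} (b : Fin k → B)
    (hb : ∀ x : B, ∃ r : R, r ≠ 0 ∧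
      r • (x : P) ∈ Submodule.span R (Set.range fun i ↦ (b i : P)) ⊔ S)
    (q : ValueClasses A hS b) :
    IsClosed {φ : S →ₗ[R] A | (φ, q) ∈ LinearMap.range (restrictAndValues A hS b)} := by
  classical
  obtain ⟨a, rfl⟩ := ValueClasses.mk_surjective hS b q
  simp only [mem_range_restrictAndValues]
  rw [isClosed_iff_frequently]
  intro φ hφ
  have hfin (Y : Finset S) : ∃ f : B →ₗ[R] A, (∀ i, f (b i) = a i) ∧
      ∀ s ∈ Y, f (Submodule.inclusion hS s) = φ s := by
    obtain ⟨ψ, ⟨f, hf, hfb⟩, hψ⟩ :=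
      (hφ.and_eventually (setOf_forall_eq_mem_nhds φ Y)).exists
    exact ⟨f, hfb, fun s hs ↦ by rw [← hψ s hs, ← hf]; rfl⟩
  choose s hs using exists_mem_determining (A := A) hS b hb
  choose f hfb hfs using hfin
  -- `f Y` and `f Z` agree at `x` as soon as both `Y` and `Z` contain the element determining `x`.
  have key (x : B) (Y : Finset S) (hY : s x ∈ Y) : f {s x} x = f Y x :=
    hs x _ _ (fun i ↦ by rw [hfb, hfb]) (by
      rw [hfs _ _ (Finset.mem_singleton_self _), hfs _ _ hY])
  refine ⟨{ toFun := fun x ↦ f {s x} x, map_add' := fun x y ↦ ?_, map_smul' := fun r x ↦ ?_ },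
    ?_, fun i ↦ hfb _ i⟩
  · rw [key x {s x, s y, s (x + y)} (by simp), key y {s x, s y, s (x + y)} (by simp),
      key (x + y) {s x, s y, s (x + y)} (by simp), map_add]
  · rw [key x {s x, s (r • x)} (by simp), key (r • x) {s x, s (r • x)} (by simp), map_smul]
    rfl
  · ext t
    change f {s (Submodule.inclusion hS t)} (Submodule.inclusion hS t) = φ t
    rw [key _ {s (Submodule.inclusion hS t), t} (by simp), hfs _ _ (by simp)]

end Germs

section Chain

open Topology Filter

attribute [local instance] homTopology

variable {R P : Type u} (A : Type u) [CommRing R] [AddCommGroup P] [Module R P] [AddCommGroup A]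
  [Module R A] {S : Submodule R P} {B : ℕ → Submodule R P} (hS : ∀ n, S ≤ B n) {k : ℕ → ℕ}
  (b : ∀ n, Fin (k n) → B n)

/-- The homomorphisms `φ : S → A` that extend to each `B n`, together with the classes of the values
at `b n` of an extension to `B n`. These classes are determined by `φ`; recording them in a discrete
module provides the Polish topology on the module of the homomorphisms that extend to each `B n`. -/
def compatibleGerms :
    Submodule R ((S →ₗ[R] A) × ∀ n, ValueClasses A (hS n) (b n)) :=
  ⨅ n, (LinearMap.range (restrictAndValues A (hS n) (b n))).comap
    (LinearMap.prodMap LinearMap.id (LinearMap.proj n))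

variable {A hS b}

theorem mem_compatibleGerms
    {x : (S →ₗ[R] A) × ∀ n, ValueClasses A (hS n) (b n)} :
    x ∈ compatibleGerms A hS b ↔
      ∀ n, (x.1, x.2 n) ∈ LinearMap.range (restrictAndValues A (hS n) (b n)) := by
  simp only [compatibleGerms, Submodule.mem_iInf]
  rfl

/-- The submodule of the homomorphisms `S → A` that extend to each `B n`. -/
def extendableToChain (A : Type u) [AddCommGroup A] [Module R A] (hS : ∀ n, S ≤ B n) :
    Submodule R (S →ₗ[R] A) :=
  ⨅ n, LinearMap.range (LinearMap.lcomp R A (Submodule.inclusion (hS n)))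

theorem mem_extendableToChain {φ : S →ₗ[R] A} :
    φ ∈ extendableToChain A hS ↔ ∀ n, ∃ f : B n →ₗ[R] A, f ∘ₗ Submodule.inclusion (hS n) = φ := by
  simp only [extendableToChain, Submodule.mem_iInf]
  rfl

variable (A hS b) in
/-- The projection from the compatible germs to the homomorphisms `S → A`. -/
def germToHom : compatibleGerms A hS b →ₗ[R] (S →ₗ[R] A) :=
  LinearMap.fst R _ _ ∘ₗ (compatibleGerms A hS b).subtype

theorem range_germToHom : LinearMap.range (germToHom A hS b) = extendableToChain A hS := by
  ext φ
  rw [mem_extendableToChain]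
  constructor
  · rintro ⟨x, rfl⟩ n
    obtain ⟨f, hf⟩ := mem_compatibleGerms.1 x.2 n
    exact ⟨f, congrArg Prod.fst hf⟩
  · intro h
    choose f hf using h
    exact ⟨⟨(φ, fun n ↦ (restrictAndValues A (hS n) (b n) (f n)).2),
      mem_compatibleGerms.2 fun n ↦ ⟨f n, Prod.ext (hf n) rfl⟩⟩, rfl⟩

theorem germToHom_injective : Function.Injective (germToHom A hS b) := by
  intro x y h
  have h1 : x.1.1 = y.1.1 := h
  refine Subtype.ext (Prod.ext h1 (funext fun n ↦ ?_))
  have hx := mem_compatibleGerms.1 x.2 n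
  rw [h1] at hx
  exact eq_of_mem_range_restrictAndValues hx (mem_compatibleGerms.1 y.2 n)

variable (A hS b) in
/-- The compatible germ of the restriction to `S` of a homomorphism on `P`. -/
def homToGerm : (P →ₗ[R] A) →ₗ[R] compatibleGerms A hS b :=
  ((LinearMap.lcomp R A S.subtype).prod (LinearMap.pi fun n ↦
      LinearMap.snd R _ _ ∘ₗ restrictAndValues A (hS n) (b n) ∘ₗ
        LinearMap.lcomp R A (B n).subtype)).codRestrict _ fun g ↦
    mem_compatibleGerms.2 fun n ↦ ⟨g ∘ₗ (B n).subtype, rfl⟩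

theorem isTopologicalAddGroup_compatibleGerms :
    IsTopologicalAddGroup (compatibleGerms A hS b) := by
  have := isTopologicalAddGroup_hom (R := R) (S := S) (A := A)
  infer_instance

theorem continuousConstSMul_compatibleGerms :
    ContinuousConstSMul R (compatibleGerms A hS b) := by
  have := continuousConstSMul_hom (R := R) (S := S) (A := A)
  have : ContinuousConstSMul R ((S →ₗ[R] A) × ∀ n, ValueClasses A (hS n) (b n)) :=
    inferInstance
  exact ⟨fun r ↦ ((continuous_const_smul r).comp continuous_subtype_val).subtype_mk _⟩

theorem continuous_germToHom : Continuous (germToHom A hS b) :=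
  continuous_fst.comp continuous_subtype_val

theorem exists_finset_of_mem_nhds_germ {x : compatibleGerms A hS b}
    {U : Set (compatibleGerms A hS b)} (hU : U ∈ 𝓝 x) :
    ∃ (Y : Finset S) (N : ℕ), ∀ y : compatibleGerms A hS b,
      (∀ s ∈ Y, y.1.1 s = x.1.1 s) → (∀ n < N, y.1.2 n = x.1.2 n) → y ∈ U := by
  rw [nhds_subtype_eq_comap, Filter.mem_comap] at hU
  obtain ⟨V, hV, hVU⟩ := hU
  obtain ⟨V₁, h₁, V₂, h₂, hV⟩ := mem_nhds_prod_iff.1 hV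
  obtain ⟨Y, hY⟩ := mem_nhds_hom_iff.1 h₁
  rw [nhds_pi] at h₂
  simp only [nhds_discrete, Filter.mem_pi, Filter.mem_pure] at h₂
  obtain ⟨I, hI, T, hT, hTV⟩ := h₂
  obtain ⟨N, hN⟩ := hI.bddAbove
  refine ⟨Y, N + 1, fun y h h' ↦ hVU (hV ⟨hY _ h, hTV fun n hn ↦ ?_⟩)⟩
  rw [h' n (Nat.lt_succ_of_le (hN hn))]
  exact hT n

theorem continuous_homToGerm : Continuous (homToGerm A hS b) := by
  classical
  refine continuous_iff_continuousAt.2 fun g U hU ↦ ?_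
  obtain ⟨Y, N, hYN⟩ := exists_finset_of_mem_nhds_germ hU
  refine mem_nhds_hom_iff.2 ⟨Y.image (↑) ∪ (Finset.range N).biUnion fun n ↦
    Finset.univ.image fun i ↦ (b n i : P), fun h hh ↦ hYN _ (fun s hs ↦ hh s ?_) fun n hn ↦ ?_⟩
  · exact Finset.mem_union_left _ (Finset.mem_image_of_mem _ hs)
  · refine congrArg (ValueClasses.mk A (hS n) (b n)) (funext fun i ↦ hh (b n i) ?_)
    exact Finset.mem_union_right _ (Finset.mem_biUnion.2
      ⟨n, Finset.mem_range.2 hn, Finset.mem_image_of_mem _ (Finset.mem_univ i)⟩)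

theorem denseRange_homToGerm (hB : Monotone B)
    (hloc : ∀ n (f : B n →ₗ[R] A) (X : Finset (B n)), ∃ g : P →ₗ[R] A, ∀ x ∈ X, g x = f x) :
    DenseRange (homToGerm A hS b) := by
  classical
  refine fun x ↦ mem_closure_iff_nhds.2 fun U hU ↦ ?_
  obtain ⟨Y, N, hYN⟩ := exists_finset_of_mem_nhds_germ hU
  obtain ⟨f, hf⟩ := mem_compatibleGerms.1 x.2 N
  have hfS : f ∘ₗ Submodule.inclusion (hS N) = x.1.1 := congrArg Prod.fst hf
  obtain ⟨g, hg⟩ := hloc N f (Y.image (Submodule.inclusion (hS N)) ∪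
    (Finset.range N).attach.biUnion fun n ↦ Finset.univ.image fun i ↦
      Submodule.inclusion (hB (Finset.mem_range.1 n.2).le) (b n i))
  refine ⟨_, hYN (homToGerm A hS b g) (fun s hs ↦ ?_) (fun n hn ↦ ?_), g, rfl⟩
  · rw [← hfS]
    exact hg (Submodule.inclusion (hS N) s)
      (Finset.mem_union_left _ (Finset.mem_image_of_mem _ hs))
  · refine eq_of_mem_range_restrictAndValues (φ := x.1.1) ?_ (mem_compatibleGerms.1 x.2 n)
    refine ⟨f ∘ₗ Submodule.inclusion (hB hn.le), Prod.ext hfS ?_⟩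
    refine congrArg (ValueClasses.mk A (hS n) (b n)) (funext fun i ↦ ?_)
    refine (hg (Submodule.inclusion (hB hn.le) (b n i)) (Finset.mem_union_right _ ?_)).symm
    exact Finset.mem_biUnion.2 ⟨⟨n, Finset.mem_range.2 hn⟩, Finset.mem_attach _ _,
      Finset.mem_image_of_mem _ (Finset.mem_univ i)⟩

section Closed

variable [IsDomain R] [Module.IsTorsionFree R A]
  (hb : ∀ n, ∀ x : B n, ∃ r : R, r ≠ 0 ∧
    r • (x : P) ∈ Submodule.span R (Set.range fun i ↦ (b n i : P)) ⊔ S)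

include hb

/-- Since the second component is discrete in each coordinate, this reduces to the closedness of the
sets of homomorphisms that extend with values in a given class. -/
theorem isClosed_compatibleGerms :
    IsClosed (compatibleGerms A hS b :
      Set ((S →ₗ[R] A) × ∀ n, ValueClasses A (hS n) (b n))) := by
  have h : (compatibleGerms A hS b : Set ((S →ₗ[R] A) × ∀ n, ValueClasses A (hS n) (b n))) =
      ⋂ n, ⋂ q, (fun x : (S →ₗ[R] A) × ∀ n, ValueClasses A (hS n) (b n) ↦ x.2 n) ⁻¹' {q}ᶜ ∪
        Prod.fst ⁻¹' {φ : S →ₗ[R] A |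
          (φ, q) ∈ LinearMap.range (restrictAndValues A (hS n) (b n))} := by
    ext x
    simp only [SetLike.mem_coe, mem_compatibleGerms, Set.mem_iInter]
    refine forall_congr' fun n ↦ ⟨fun h q ↦ ?_, fun h ↦ (h (x.2 n)).resolve_left fun h ↦ h rfl⟩
    by_cases hq : x.2 n = q
    · exact Or.inr (hq ▸ h)
    · exact Or.inl hq
  rw [h]
  refine isClosed_iInter fun n ↦ isClosed_iInter fun q ↦ IsClosed.union ?_ ?_
  · exact IsClosed.preimage ((continuous_apply n).comp continuous_snd) (isClosed_discrete _)
  · exact (isClosed_setOf_mem_range_restrictAndValues (hS n) (b n) (hb n) q).preimage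
      continuous_fst

theorem polishSpace_compatibleGerms [Countable S] [Countable A] :
    PolishSpace (compatibleGerms A hS b) := by
  have := polishSpace_hom (R := R) (S := S) (A := A)
  have : PolishSpace (∀ n, ValueClasses A (hS n) (b n)) := inferInstance
  have : PolishSpace ((S →ₗ[R] A) × ∀ n, ValueClasses A (hS n) (b n)) := inferInstance
  exact (isClosed_compatibleGerms hb).polishSpace

theorem isPiZeroThree_extendableToChain [Countable A] :
    IsPiZeroThree (extendableToChain A hS : Set (S →ₗ[R] A)) := by
  choose e he using fun n ↦ exists_surjective_nat (ValueClasses A (hS n) (b n))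
  refine ⟨fun n j ↦ {φ | (φ, e n j) ∈ LinearMap.range (restrictAndValues A (hS n) (b n))},
    fun n j ↦ isClosed_setOf_mem_range_restrictAndValues (hS n) (b n) (hb n) _, ?_⟩
  ext φ
  simp only [SetLike.mem_coe, mem_extendableToChain, Set.mem_iInter, Set.mem_iUnion]
  refine forall_congr' fun n ↦ ⟨?_, ?_⟩
  · rintro ⟨f, rfl⟩
    obtain ⟨j, hj⟩ := he n (restrictAndValues A (hS n) (b n) f).2
    exact ⟨j, f, Prod.ext rfl hj.symm⟩
  · rintro ⟨j, f, hf⟩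
    exact ⟨f, congrArg Prod.fst hf⟩

/-- If a homomorphism `f` on `B n` extends `ψ : S → A` and vanishes at `b n`, and if `ψ` vanishes on
a suitable finite set, then `f` vanishes on a given finite set `X`; homomorphisms on `P` that agree
with `f` on `X` and on larger and larger finite subsets of `S` approximate `ψ`. -/
theorem eventually_mem_closure_image (hB : Monotone B) (hex : ∀ x : P, ∃ n, x ∈ B n)
    (hloc : ∀ n (f : B n →ₗ[R] A) (X : Finset (B n)), ∃ g : P →ₗ[R] A, ∀ x ∈ X, g x = f x)
    {U : Set (P →ₗ[R] A)} (hU : U ∈ 𝓝 0) :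
    ∀ᶠ y in 𝓝 (0 : compatibleGerms A hS b),
      germToHom A hS b y ∈ closure ((germToHom A hS b ∘ homToGerm A hS b) '' U) := by
  classical
  obtain ⟨X, hX⟩ := mem_nhds_hom_iff.1 hU
  choose N hN using hex
  let n := X.sup N
  have hXn (x) (hx : x ∈ X) : x ∈ B n := hB (Finset.le_sup hx) (hN x)
  choose s hs using exists_mem_determining (A := A) (hS n) (b n) (hb n)
  let e : X → B n := fun x ↦ ⟨x.1, hXn x.1 x.2⟩
  have h1 : ∀ᶠ y in 𝓝 (0 : compatibleGerms A hS b), ∀ t ∈ Finset.univ.image (s ∘ e),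
      germToHom A hS b y t = 0 :=
    (continuous_germToHom (A := A) (hS := hS) (b := b)).continuousAt.preimage_mem_nhds
      (t := {ψ : S →ₗ[R] A | ∀ t ∈ Finset.univ.image (s ∘ e), ψ t = (0 : S →ₗ[R] A) t})
      (by rw [map_zero]; exact setOf_forall_eq_mem_nhds 0 (Finset.univ.image (s ∘ e)))
  have h2 : ∀ᶠ y in 𝓝 (0 : compatibleGerms A hS b), y.1.2 n = 0 :=
    ((continuous_apply n).comp
      (continuous_snd.comp continuous_subtype_val)).continuousAt.preimage_mem_nhds
      (t := {0}) (by rw [nhds_discrete]; exact rfl)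
  filter_upwards [h1, h2] with y hy1 hy2
  have hy := mem_compatibleGerms.1 y.2 n
  rw [hy2, ← map_zero (ValueClasses.mk A (hS n) (b n)), mem_range_restrictAndValues] at hy
  obtain ⟨f, hfS, hfb⟩ := hy
  refine mem_closure_iff_nhds.2 fun V hV ↦ ?_
  obtain ⟨Z, hZ⟩ := mem_nhds_hom_iff.1 hV
  obtain ⟨g, hg⟩ := hloc n f (Finset.univ.image e ∪
    Z.image (Submodule.inclusion (hS n)))
  refine ⟨_, hZ _ fun t ht ↦ ?_, g, hX g fun x hx ↦ ?_, rfl⟩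
  · have h := hg (Submodule.inclusion (hS n) t)
      (Finset.mem_union_right _ (Finset.mem_image_of_mem _ ht))
    exact h.trans (LinearMap.congr_fun hfS t)
  · have h := hg (e ⟨x, hx⟩)
      (Finset.mem_union_left _ (Finset.mem_image_of_mem _ (Finset.mem_univ _)))
    refine h.trans (hs (e ⟨x, hx⟩) f 0 hfb ?_)
    exact (LinearMap.congr_fun hfS _).trans
      (hy1 _ (Finset.mem_image_of_mem (s ∘ e) (Finset.mem_univ _)))

/-- Let `B n` be an exhausting chain of submodules of a countable module `P` between `S` and `P`,
each contained in the pure closure of `S` and finitely many elements. If each homomorphism on `B n`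
agrees on each finite set with a homomorphism on `P`, then the first Solecki submodule consists of
the homomorphisms that extend to each `B n`. -/
theorem isFirstSolecki_extendableToChain [Countable P] [Countable A] (hB : Monotone B)
    (hex : ∀ x : P, ∃ n, x ∈ B n)
    (hloc : ∀ n (f : B n →ₗ[R] A) (X : Finset (B n)), ∃ g : P →ₗ[R] A, ∀ x ∈ X, g x = f x) :
    IsFirstSolecki (LinearMap.range (LinearMap.lcomp R A S.subtype))
      (extendableToChain A hS) := by
  have := isTopologicalAddGroup_hom (R := R) (S := S) (A := A)
  have := isTopologicalAddGroup_hom (R := R) (S := P) (A := A)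
  have := polishSpace_hom (R := R) (S := P) (A := A)
  have := polishSpace_compatibleGerms (A := A) (hS := hS) hb
  have := isTopologicalAddGroup_compatibleGerms (A := A) (hS := hS) (b := b)
  have := continuousConstSMul_compatibleGerms (A := A) (hS := hS) (b := b)
  refine ⟨⟨?_, ?_, isPiZeroThree_extendableToChain hb⟩, fun L hL ↦ ?_⟩
  · rintro _ ⟨g, rfl⟩
    exact mem_extendableToChain.2 fun n ↦ ⟨g ∘ₗ (B n).subtype, rfl⟩
  · rw [← range_germToHom (b := b)]
    exact isPolishable_range _ continuous_germToHom germToHom_injective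
  · rw [← range_germToHom (b := b)]
    exact range_le_of_isPiZeroThree (homToGerm A hS b) _ continuous_homToGerm
      continuous_germToHom (denseRange_homToGerm hB hloc)
      (fun U hU ↦ eventually_mem_closure_image hb hB hex hloc hU) L hL.1 hL.2.2

end Closed

end Chain

/-! ### A chain of finite-rank pure submodules -/

section FiniteRankChain

variable {R : Type u} [CommRing R]

/-- The pure closures of the initial segments of a sequence in a module over a domain. -/
def finiteRankChain (R : Type u) [CommRing R] [IsDomain R] {C : Type u} [AddCommGroup C]
    [Module R C] (e : ℕ → C) (n : ℕ) : Submodule R C :=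
  pureClosure (e '' Set.Iio n)

variable {C : Type u} [AddCommGroup C] [Module R C] {e : ℕ → C}

theorem monotone_finiteRankChain [IsDomain R] : Monotone (finiteRankChain R e) :=
  fun _ _ h ↦ pureClosure_mono (Set.image_mono (Set.Iio_subset_Iio h))

theorem hasFiniteRank_finiteRankChain [IsDomain R] (n : ℕ) :
    HasFiniteRank R (finiteRankChain R e n) :=
  hasFiniteRank_pureClosure ((Set.finite_Iio n).image e)

theorem exists_le_finiteRankChain [IsDomain R] (he : Function.Surjective e) {t : Set C}
    (ht : t.Finite) : ∃ n, pureClosure (R := R) t ≤ finiteRankChain R e n := by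
  choose N hN using he
  obtain ⟨m, hm⟩ := (ht.image N).bddAbove
  refine ⟨m + 1, pureClosure_mono fun c hc ↦ ⟨N c, ?_, hN c⟩⟩
  exact Nat.lt_succ_of_le (hm ⟨c, hc, rfl⟩)

theorem exists_mem_finiteRankChain [IsDomain R] (he : Function.Surjective e) (c : C) :
    ∃ n, c ∈ finiteRankChain R e n := by
  obtain ⟨n, hn⟩ := exists_le_finiteRankChain (R := R) he (Set.finite_singleton c)
  exact ⟨n, hn (subset_pureClosure _ rfl)⟩

theorem HasFiniteRank.exists_range_le_finiteRankChain [IsDomain R] (he : Function.Surjective e)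
    {X : Type u} [AddCommGroup X] [Module R X] (h : HasFiniteRank R X) (f : X →ₗ[R] C) :
    ∃ n, LinearMap.range f ≤ finiteRankChain R e n := by
  obtain ⟨t, ht, hft⟩ := h.exists_range_le_pureClosure f
  obtain ⟨n, hn⟩ := exists_le_finiteRankChain (R := R) he ht
  exact ⟨n, hft.trans hn⟩

end FiniteRankChain

/-! ### The first Solecki submodule of `Ext¹` -/

section FirstSolecki

variable {R : Type u} [CommRing R] [IsPruferDomain R]

theorem comap_connecting_extSplitSubmodule {C A : ModuleCat.{u} R} {e : ℕ → C}
    (he : Function.Surjective e) {P : Type u} [AddCommGroup P] [Module R P] (π : P →ₗ[R] C)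
    (hπ : Function.Surjective π) :
    (extSplitSubmodule C A).comap (connecting (A := A) π hπ) =
      extendableToChain A (B := fun n ↦ (finiteRankChain R e n).comap π)
        (fun _ ↦ LinearMap.ker_le_comap π) := by
  ext φ
  rw [mem_extendableToChain]
  constructor
  · intro h n
    exact (mk₀_comp_connecting_eq_zero_iff π hπ _ φ).1
      (h _ (isPureSubmodule_pureClosure _) (hasFiniteRank_finiteRankChain n))
  · intro h B _ hr
    obtain ⟨n, hn⟩ := hr.exists_range_le_finiteRankChain he B.subtype
    rw [Submodule.range_subtype] at hn
    obtain ⟨f, rfl⟩ := h n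
    exact (mk₀_comp_connecting_eq_zero_iff π hπ B _).2
      ⟨f ∘ₗ Submodule.inclusion (Submodule.comap_mono hn), rfl⟩

theorem isFirstSoleckiExt_extSplitSubmodule (C A : ModuleCat.{u} R) [Countable C] [Countable A]
    [Module.Flat R A] : IsFirstSoleckiExt C A (extSplitSubmodule C A) := by
  classical
  intro P _ _ _ _ π hπ
  obtain ⟨e, he⟩ := exists_surjective_nat C
  rw [comap_connecting_extSplitSubmodule he]
  choose σ hσ using hπ
  refine isFirstSolecki_extendableToChain (k := id)
    (b := fun n i ↦ ⟨σ (e i), ?_⟩) (fun n x ↦ ?_) ?_ ?_ ?_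
  · rw [Submodule.mem_comap, hσ]
    exact subset_pureClosure _ ⟨i, i.2, rfl⟩
  · obtain ⟨r, hr, hx⟩ := mem_pureClosure.1 (Submodule.mem_comap.1 x.2)
    refine ⟨r, hr, ?_⟩
    rw [← Submodule.comap_map_eq, Submodule.mem_comap, Submodule.map_span, map_smul]
    refine Submodule.span_mono ?_ hx
    rintro _ ⟨i, hi, rfl⟩
    exact ⟨σ (e i), ⟨⟨i, hi⟩, rfl⟩, hσ _⟩
  · exact fun m n h ↦ Submodule.comap_mono (monotone_finiteRankChain h)
  · exact fun x ↦ exists_mem_finiteRankChain he (π x)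
  · intro n f X
    have : Module.Flat R (C ⧸ finiteRankChain R e n) :=
      have : Module.IsTorsionFree R (C ⧸ finiteRankChain R e n) :=
        isTorsionFree_quotient_pureClosure _
      flat_of_isTorsionFree _
    obtain ⟨θ, hθ, hθX⟩ := exists_endomorphism_fixing_finset
      ((finiteRankChain R e n).mkQ ∘ₗ π)
      ((Submodule.mkQ_surjective _).comp fun c ↦ ⟨σ c, hσ c⟩) (X.image (↑)) (by
        intro x hx
        obtain ⟨x, -, rfl⟩ := Finset.mem_image.1 hx
        exact (Submodule.Quotient.mk_eq_zero _).2 x.2)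
    refine ⟨f ∘ₗ θ.codRestrict _ fun x ↦ Submodule.mem_comap.2
      ((Submodule.Quotient.mk_eq_zero (finiteRankChain R e n)).1 (LinearMap.congr_fun hθ x)),
      fun x hx ↦ ?_⟩
    exact congrArg f (Subtype.ext (hθX x (Finset.mem_image_of_mem _ hx)))

/-- `C` has `A`-projective length at most one if and only if all extensions of `C` by `A` that
belong to `𝓔₁` split. -/
theorem projLengthLEOneAt_iff [Countable R] (C A : ModuleCat.{u} R) [Countable C]
    [Module.Flat R C] [Countable A] [Module.Flat R A] :
    ProjLengthLEOneAt C A ↔ ∀ e ∈ extE1 C A, e = 0 := by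
  have hE : (∀ e ∈ extE1 C A, e = 0) ↔ extSplitSubmodule C A = ⊥ := by
    rw [extE1_eq_extSplitOnFiniteRank C A ‹_› ‹_›, Submodule.eq_bot_iff]
    rfl
  rw [hE]
  constructor
  · intro h
    have hπ := Finsupp.linearCombination_id_surjective R C
    have h1 := isFirstSoleckiExt_extSplitSubmodule C A (C →₀ R) _ hπ
    have h2 := h (C →₀ R) _ hπ
    exact Submodule.comap_injective_of_surjective (connecting_surjective _ hπ)
      (IsLeast.unique h1 h2)
  · intro h
    have := isFirstSoleckiExt_extSplitSubmodule C A
    rwa [h] at this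

end FirstSolecki

/-! ### The telescope of a chain -/

section Telescope

variable {R : Type u} [CommRing R] {C : Type u} [AddCommGroup C] [Module R C]
  {B : ℕ → Submodule R C} (hB : Monotone B)

/-- The map `⨁ B n → C` induced by the inclusions. -/
def telescopeSum (B : ℕ → Submodule R C) : (⨁ n, B n) →ₗ[R] C :=
  DirectSum.toModule R ℕ C fun n ↦ (B n).subtype

/-- The map `⨁ B n → ⨁ B n` that sends `c` in degree `n` to `c` in degree `n` minus `c` in
degree `n + 1`. -/
def telescopeDiff : (⨁ n, B n) →ₗ[R] ⨁ n, B n :=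
  DirectSum.toModule R ℕ _ fun n ↦ DirectSum.lof R ℕ (fun n ↦ B n) n -
    DirectSum.lof R ℕ (fun n ↦ B n) (n + 1) ∘ₗ Submodule.inclusion (hB n.le_succ)

theorem telescopeSum_lof (n : ℕ) (c : B n) :
    telescopeSum B (DirectSum.lof R ℕ (fun n ↦ B n) n c) = c := by
  simp [telescopeSum]

theorem telescopeSum_comp_telescopeDiff : telescopeSum B ∘ₗ telescopeDiff hB = 0 := by
  ext n c
  simp [telescopeSum, telescopeDiff]

theorem telescopeDiff_apply_zero (x : ⨁ n, B n) : (telescopeDiff hB x 0 : C) = x 0 := by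
  induction x using DirectSum.induction_on with
  | zero => simp
  | add x y hx hy => simp [hx, hy]
  | of n c =>
    rw [← DirectSum.lof_eq_of R, telescopeDiff, DirectSum.toModule_lof]
    simp [DirectSum.lof_eq_of, DirectSum.coe_of_apply]

theorem telescopeDiff_apply_succ (x : ⨁ n, B n) (m : ℕ) :
    (telescopeDiff hB x (m + 1) : C) = x (m + 1) - x m := by
  induction x using DirectSum.induction_on with
  | zero => simp
  | add x y hx hy => simp only [map_add, DirectSum.add_apply, Submodule.coe_add, hx, hy]; abel
  | of n c =>
    rw [← DirectSum.lof_eq_of R, telescopeDiff, DirectSum.toModule_lof]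
    simp only [DirectSum.lof_eq_of, DirectSum.coe_of_apply, LinearMap.sub_apply,
      LinearMap.comp_apply, DirectSum.sub_apply, Submodule.coe_sub, add_left_inj, sub_right_inj]
    split_ifs <;> rfl

theorem telescopeDiff_injective : Function.Injective (telescopeDiff hB) := by
  refine (injective_iff_map_eq_zero _).2 fun x hx ↦ DFinsupp.ext fun n ↦ Subtype.ext ?_
  induction n with
  | zero => rw [← telescopeDiff_apply_zero hB, hx]
  | succ n ih =>
    have h := telescopeDiff_apply_succ hB x n
    rw [hx, ih] at h
    simpa using h.symm

theorem lof_sub_lof_mem_range_telescopeDiff {n m : ℕ} (h : n ≤ m) (c : B n) :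
    DirectSum.lof R ℕ (fun n ↦ B n) n c -
      DirectSum.lof R ℕ (fun n ↦ B n) m (Submodule.inclusion (hB h) c) ∈
        LinearMap.range (telescopeDiff hB) := by
  induction m, h using Nat.le_induction with
  | base => exact ⟨0, by rw [map_zero]; exact (sub_self _).symm⟩
  | succ m h ih =>
    have h1 : telescopeDiff hB (DirectSum.lof R ℕ (fun n ↦ B n) m (Submodule.inclusion (hB h) c)) ∈
      LinearMap.range (telescopeDiff hB) := ⟨_, rfl⟩
    have h2 := add_mem ih h1
    rw [telescopeDiff, DirectSum.toModule_lof, LinearMap.sub_apply, sub_add_sub_cancel] at h2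
    exact h2

/-- Modulo the range of the difference map, each element of `⨁ B n` is concentrated in one degree,
where the map to `C` is injective. -/
theorem ker_telescopeSum_le :
    LinearMap.ker (telescopeSum B) ≤ LinearMap.range (telescopeDiff hB) := by
  have key (x : ⨁ n, B n) : ∃ (n : ℕ) (c : B n),
      x - DirectSum.lof R ℕ (fun n ↦ B n) n c ∈ LinearMap.range (telescopeDiff hB) := by
    induction x using DirectSum.induction_on with
    | zero => exact ⟨0, 0, by simp⟩
    | of n c => exact ⟨n, c, ⟨0, by rw [map_zero]; exact (sub_self _).symm⟩⟩
    | add x y hx hy =>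
      obtain ⟨n, c, hc⟩ := hx
      obtain ⟨m, d, hd⟩ := hy
      refine ⟨max n m, Submodule.inclusion (hB (le_max_left n m)) c +
        Submodule.inclusion (hB (le_max_right n m)) d, ?_⟩
      have h1 := add_mem hc (lof_sub_lof_mem_range_telescopeDiff hB (le_max_left n m) c)
      have h2 := add_mem hd (lof_sub_lof_mem_range_telescopeDiff hB (le_max_right n m) d)
      rw [sub_add_sub_cancel] at h1 h2
      rw [map_add, add_sub_add_comm]
      exact add_mem h1 h2
  intro x hx
  obtain ⟨n, c, y, hy⟩ := key x
  have h1 : telescopeSum B (telescopeDiff hB y) = 0 :=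
    LinearMap.congr_fun (telescopeSum_comp_telescopeDiff hB) y
  rw [hy, map_sub, LinearMap.mem_ker.1 hx, telescopeSum_lof, zero_sub, neg_eq_zero] at h1
  have hc : c = 0 := Subtype.ext h1
  rw [hc, map_zero, sub_zero] at hy
  exact ⟨y, hy⟩

end Telescope

/-! ### Modules of projective length at most one -/

section ProjectiveLength

variable {R : Type u} [CommRing R]

/-- If `C` is a direct summand of a direct sum of finite-rank flat modules, then the projection onto
`C` lifts to each extension in `𝓔₁`, so that the extension splits. -/
theorem eq_zero_of_mem_extE1 {C A : ModuleCat.{u} R} (hC : IsSummandOfFiniteRankSum C)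
    {e : Ext C A 1} (he : e ∈ extE1 C A) : e = 0 := by
  obtain ⟨F, hF, i, r, hir⟩ := hC
  obtain ⟨B, j, p, w, h, hE, rfl⟩ := he
  choose g hg using fun n ↦ hE.2 (F n) (hF n).1 (hF n).2.1 (hF n).2.2
    (ModuleCat.ofHom (r ∘ₗ DirectSum.lof R ℕ (fun n ↦ F n) n))
  let s : (⨁ n, F n) →ₗ[R] B := DirectSum.toModule R ℕ B fun n ↦ (g n).hom
  have hs : p.hom ∘ₗ s = r := by
    refine DirectSum.linearMap_ext R fun n ↦ ?_
    rw [LinearMap.comp_assoc]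
    have h1 : s ∘ₗ DirectSum.lof R ℕ (fun n ↦ F n) n = (g n).hom := by
      exact LinearMap.ext fun x ↦ DirectSum.toModule_lof R (φ := fun n ↦ (g n).hom) n x
    rw [h1]
    exact congrArg ModuleCat.Hom.hom (hg n)
  have h0 := (exists_lift_iff_mk₀_comp_extClass_eq_zero h (𝟙 C)).1
    ⟨ModuleCat.ofHom (s ∘ₗ i), by
      apply ModuleCat.hom_ext
      change p.hom ∘ₗ (s ∘ₗ i) = LinearMap.id
      rw [← LinearMap.comp_assoc, hs, hir]⟩
  rwa [Ext.mk₀_id_comp] at h0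

/-- The telescope of a chain of finite-rank pure submodules `B n` of `C` is an extension of `C` by
`⨁ B n` in `𝓔₁`. If it splits, then `C` is a direct summand of `⨁ B n`. -/
theorem isSummandOfFiniteRankSum_of_projLengthLEOneAt [IsPruferDomain R] [Countable R]
    (C : ModuleCat.{u} R)
    [Countable C] [Module.Flat R C]
    (h : ∀ F : ℕ → ModuleCat.{u} R, IsFiniteRankFlatSeq F →
      ProjLengthLEOneAt C (ModuleCat.of R (⨁ n, F n))) : IsSummandOfFiniteRankSum C := by
  obtain ⟨e, he⟩ := exists_surjective_nat C
  let B := finiteRankChain R e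
  have hB : Monotone B := monotone_finiteRankChain
  let F : ℕ → ModuleCat.{u} R := fun n ↦ ModuleCat.of R (B n)
  have hF : IsFiniteRankFlatSeq F := fun n ↦
    ⟨inferInstanceAs (Countable (B n)), (isPureSubmodule_pureClosure _).flat,
      hasFiniteRank_finiteRankChain n⟩
  let i : ModuleCat.of R (⨁ n, F n) ⟶ ModuleCat.of R (⨁ n, F n) :=
    ModuleCat.ofHom (telescopeDiff hB)
  let p : ModuleCat.of R (⨁ n, F n) ⟶ C := ModuleCat.ofHom (telescopeSum B)
  have w : i ≫ p = 0 := ModuleCat.hom_ext (telescopeSum_comp_telescopeDiff hB)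
  have hex : (ShortComplex.mk i p w).ShortExact := by
    refine { exact := ?_, mono_f := ?_, epi_g := ?_ }
    · rw [ShortComplex.moduleCat_exact_iff]
      exact fun x hx ↦ ker_telescopeSum_le hB hx
    · exact (ModuleCat.mono_iff_injective i).2 (telescopeDiff_injective hB)
    · refine (ModuleCat.epi_iff_surjective p).2 fun c ↦ ?_
      obtain ⟨n, hn⟩ := exists_mem_finiteRankChain (R := R) he c
      exact ⟨DirectSum.lof R ℕ (fun n ↦ B n) n ⟨c, hn⟩, telescopeSum_lof n _⟩
  have hE : IsE1Exact (ShortComplex.mk i p w) := by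
    refine ⟨hex, fun X _ _ hr f ↦ ?_⟩
    obtain ⟨n, hn⟩ := hr.exists_range_le_finiteRankChain he f.hom
    refine ⟨ModuleCat.ofHom (DirectSum.lof R ℕ (fun n ↦ B n) n ∘ₗ
      f.hom.codRestrict _ fun x ↦ hn ⟨x, rfl⟩), ?_⟩
    ext x
    exact telescopeSum_lof (B := B) n ⟨f.hom x, hn ⟨x, rfl⟩⟩
  have hcount (n : ℕ) : Countable (F n) := (hF n).1
  have hflat (n : ℕ) : Module.Flat R (F n) := (hF n).2.1
  have : Countable (⨁ n, F n) := inferInstanceAs (Countable (Π₀ n, F n))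
  have h0 := (projLengthLEOneAt_iff C (ModuleCat.of R (⨁ n, F n))).1 (h F hF) hex.extClass
    ⟨_, i, p, w, hex, hE, rfl⟩
  obtain ⟨s, hs⟩ := (exists_lift_iff_mk₀_comp_extClass_eq_zero hex (𝟙 C)).2
    (by rw [h0, Ext.comp_zero])
  exact ⟨F, hF, s.hom, p.hom, congrArg ModuleCat.Hom.hom hs⟩

end ProjectiveLength

end FlatExt

end

theorem mainTheorem9 (R : Type u) [CommRing R] [Countable R] [FlatExt.IsPruferDomain R] :
    (∀ C A : ModuleCat.{u} R, Countable C → Module.Flat R C → Countable A → Module.Flat R A →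
      ∃ E : Submodule R (Ext C A 1),
        (E : Set (Ext C A 1)) = FlatExt.extE1 C A ∧
        (E : Set (Ext C A 1)) = FlatExt.extSplitOnFiniteRank C A ∧
        FlatExt.IsFirstSoleckiExt C A E) ∧
    (∀ C : ModuleCat.{u} R, Countable C → Module.Flat R C → FlatExt.IsCoreduced C →
      List.TFAE
        [FlatExt.ProjLengthLEOne C,
         ∀ F : ℕ → ModuleCat.{u} R, FlatExt.IsFiniteRankFlatSeq F →
           FlatExt.ProjLengthLEOneAt C (ModuleCat.of R (⨁ n, F n)),
         FlatExt.IsSummandOfFiniteRankSum C]) := by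
  refine ⟨fun C A _ _ _ _ ↦ ⟨FlatExt.extSplitSubmodule C A,
    (FlatExt.extE1_eq_extSplitOnFiniteRank C A ‹_› ‹_›).symm, rfl,
    FlatExt.isFirstSoleckiExt_extSplitSubmodule C A⟩, fun C _ _ _ ↦ ?_⟩
  tfae_have 1 → 2 := by
    intro h F hF
    have hcount (n : ℕ) : Countable (F n) := (hF n).1
    have hflat (n : ℕ) : Module.Flat R (F n) := (hF n).2.1
    exact h _ (inferInstanceAs (Countable (Π₀ n, F n)))
      (inferInstanceAs (Module.Flat R (⨁ n, F n)))
  tfae_have 2 → 3 := FlatExt.isSummandOfFiniteRankSum_of_projLengthLEOneAt C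
  tfae_have 3 → 1 := fun h A _ _ ↦
    (FlatExt.projLengthLEOneAt_iff C A).2 fun _ he ↦ FlatExt.eq_zero_of_mem_extE1 h he
  tfae_finish
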